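/- Let $a_0,a_1,a_2\in\mathbb R$ with $a_2>0$, let $V(x)=a_2x^2+a_1x+a_0$ for $x\in\mathbb R$, and let $H=-\frac{d^2}{dx^2}+V$ be the operator on $L^2(\mathbb R)$ (with real or complex scalars) associated with the form $$\mathfrak a(u,v)=\int_{\mathbb R}\bigl(u'\,\overline{v'}+V\,u\,\overline v\bigr)\,dx,\qquad \operatorname{dom}\mathfrak a=\Bigl\{u\in H^1(\mathbb R):\int_{\mathbb R}|V|\,|u|^2\,dx<\infty\Bigr\};$$ that is, $u\in\operatorname{dom}H$ and $Hu=h\in L^2(\mathbb R)$ if and only if $u\in\operatorname{dom}\mathfrak a$ and $\mathfrak a(u,v)=\int_{\mathbb R} h\,\overline v\,dx$ for all $v\in\operatorname{dom}\mathfrak a$. A real function $p(x,y,t)$, $x,y\in\mathbb R$, $t>0$, measurable in $(x,y)$, is called a heat kernel of $H$ if for every $f\in L^2(\mathbb R)$ the problem $$\partial_tu+Hu=0\quad(t>0),\qquad \lim_{t\to0^+}u(\cdot,t)=f,$$ with the derivative and the limit taken in $L^2(\mathbb R)$ and $u(\cdot,t)\in\operatorname{dom}H$ for $t>0$, has a solution,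 and every solution satisfies, for each $t>0$ and almost every $x$, $$u(x,t)=e^{-tH}f(x)=\int_{\mathbb R}p(x,y,t)f(y)\,dy$$ with an absolutely convergent integral. Then the function \begin{align*} p(x,y,t)={}&\left(\frac{\sqrt{a_2}\,\operatorname{csch}(2\sqrt{a_2}\,t)}{2\pi}\right)^{1/2}e^{\left(\frac{a_1^2}{4a_2}-a_0\right)t}\\ &\cdot\exp\left\{-\frac{a_1^2}{4(\sqrt{a_2})^3}\bigl(\coth(2\sqrt{a_2}\,t)-\operatorname{csch}(2\sqrt{a_2}\,t)\bigr)\right\}\\ &\cdot\exp\left\{-\frac{\sqrt{a_2}}2\Bigl((x-y)^2\operatorname{csch}(2\sqrt{a_2}\,t)+(x^2+y^2)\bigl(\coth(2\sqrt{a_2}\,t)-\operatorname{csch}(2\sqrt{a_2}\,t)\bigr)\Bigr)\right\}\\ &\cdot\exp\left\{-\frac{a_1}{2\sqrt{a_2}}(x+y)\bigl(\coth(2\sqrt{a_2}\,t)-\operatorname{csch}(2\sqrt{a_2}\,t)\bigr)\right\} \end{align*} is a heat kernel of $H$ and is continuous in $(x,y)\in\mathbb R^2$ for each $t>0$. It is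 the only one: every heat kernel of $H$ agrees with it for each $t>0$ at almost every $(x,y)\in\mathbb R^2$, and, for each $t>0$ at which the heat kernel is continuous in $(x,y)$, at all $x,y\in\mathbb R$. -/

import Mathlib

open MeasureTheory Filter Topology
open scoped ContDiff

noncomputable section

namespace Schrodinger

/-- `L²(ℝ)` with respect to Lebesgue measure, with scalars `𝕜 = ℝ` or `ℂ`. -/
abbrev L2 (𝕜 : Type*) [RCLike 𝕜] : Type _ := Lp 𝕜 2 (volume : Measure ℝ)

/-- `u' ∈ L²(ℝ)` is the weak derivative of `u ∈ L²(ℝ)`; thus `u ∈ H¹(ℝ)`. -/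
def HasWeakDeriv {𝕜 : Type*} [RCLike 𝕜] (u u' : L2 𝕜) : Prop :=
  ∀ φ : ℝ → ℝ, ContDiff ℝ ∞ φ → HasCompactSupport φ →
    ∫ x, deriv φ x • u x = -∫ x, φ x • u' x

/-- `u` lies in the domain of the Dirichlet form of `-d²/dx² + V`, that is,
`u ∈ H¹(ℝ)` and `∫ |V| |u|² < ∞`; and `u'` is its weak derivative. -/
structure InFormDomain {𝕜 : Type*} [RCLike 𝕜] (V : ℝ → ℝ) (u u' : L2 𝕜) : Prop where
  weakDeriv : HasWeakDeriv u u'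
  potential : Integrable (fun x => V x * ‖u x‖ ^ 2)

/-- The Dirichlet form `∫ (u' conj(v') + V u conj(v)) dx`; Mathlib's inner product is
conjugate-linear in its first argument. -/
def form {𝕜 : Type*} [RCLike 𝕜] (V : ℝ → ℝ) (u u' v v' : L2 𝕜) : 𝕜 :=
  ∫ x, (inner 𝕜 (v' x) (u' x) + V x • inner 𝕜 (v x) (u x))

/-- The graph of the operator `H = -d²/dx² + V` on `L²(ℝ)` associated with the Dirichlet form:
`u` is in the domain of `H` and `H u = h`. -/
def OperatorGraph {𝕜 : Type*} [RCLike 𝕜] (V : ℝ → ℝ) (u h : L2 𝕜) : Prop :=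
  ∃ u' : L2 𝕜, InFormDomain V u u' ∧
    ∀ v v' : L2 𝕜, InFormDomain V v v' → form V u u' v v' = inner 𝕜 v h

/-- `u` solves `∂ₜ u + H u = 0` on `(0, ∞)` with `u(t) → f` as `t → 0⁺`, where the derivative
and the limit are taken in `L²(ℝ)`. For `H` self-adjoint and bounded below and any `f ∈ L²(ℝ)`
the function `u(t) = e^{-tH} f` is the only such solution. The values `u t` with `t ≤ 0` are
irrelevant. -/
structure IsHeatSolution {𝕜 : Type*} [RCLike 𝕜] (V : ℝ → ℝ) (f : L2 𝕜) (u : ℝ → L2 𝕜) :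
    Prop where
  equation : ∀ t : ℝ, 0 < t → ∃ h : L2 𝕜, OperatorGraph V (u t) h ∧ HasDerivAt u (-h) t
  initial : Tendsto u (𝓝[>] 0) (𝓝 f)

/-- `p(x, y, t)` is a heat kernel of `H = -d²/dx² + V` on `L²(ℝ)`: the heat equation of `H` is
solvable for every initial value `f ∈ L²(ℝ)`, and each solution is given, for every `t > 0` and
almost every `x`, by the convergent integral `∫ p(x, y, t) f(y) dy`. -/
structure IsHeatKernel (𝕜 : Type*) [RCLike 𝕜] (V : ℝ → ℝ) (p : ℝ → ℝ → ℝ → ℝ) : Prop where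
  measurable : ∀ t : ℝ, 0 < t →
    AEStronglyMeasurable (fun z : ℝ × ℝ => p z.1 z.2 t) (volume : Measure (ℝ × ℝ))
  exists_solution : ∀ f : L2 𝕜, ∃ u : ℝ → L2 𝕜, IsHeatSolution V f u
  representation : ∀ (f : L2 𝕜) (u : ℝ → L2 𝕜), IsHeatSolution V f u → ∀ t : ℝ, 0 < t →
    ∀ᵐ x : ℝ, Integrable (fun y => p x y t • f y) ∧ u t x = ∫ y, p x y t • f y

/-- Hyperbolic cosecant. -/
def csch (s : ℝ) : ℝ := 1 / Real.sinh s

/-- Hyperbolic cotangent. -/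
def coth (s : ℝ) : ℝ := Real.cosh s / Real.sinh s

/-- The closed formula for the potential `a₂ x² + a₁ x + a₀`. -/
def quadraticKernel (a₀ a₁ a₂ x y t : ℝ) : ℝ :=
  √(√a₂ * csch (2 * √a₂ * t) / (2 * Real.pi))
    * Real.exp ((a₁ ^ 2 / (4 * a₂) - a₀) * t)
    * Real.exp (-(a₁ ^ 2 / (4 * √a₂ ^ 3)) * (coth (2 * √a₂ * t) - csch (2 * √a₂ * t)))
    * Real.exp (-(√a₂ / 2) * ((x - y) ^ 2 * csch (2 * √a₂ * t)
        + (x ^ 2 + y ^ 2) * (coth (2 * √a₂ * t) - csch (2 * √a₂ * t))))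
    * Real.exp (-(a₁ / (2 * √a₂)) * ((x + y) * (coth (2 * √a₂ * t) - csch (2 * √a₂ * t))))

end Schrodinger

end

noncomputable section

namespace Schrodinger

variable {𝕜 : Type*} [RCLike 𝕜]

/-! Completing the square gives `V = c²(x + b)² + l` with `c = √a₂`, `b = a₁/(2a₂)`, `l = a₀ -
a₁²/(4a₂)`. So `H` is a harmonic oscillator up to a translation and an additive constant, and the
asserted formula is Mehler's kernel in shifted coordinates (`quadraticKernel_eq_mehler`). No
spectral theory enters.

Solutions are unique by an energy estimate: since `H ≥ l`, the quantity `e^{2lt}‖u - v‖²` is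
nonincreasing, and its limit at `0⁺` is zero (`IsHeatSolution.unique`). It remains to see that the
Mehler operators produce one solution. The kernel satisfies `∂ₜK = ∂ₓ²K - VK` by direct computation
(`mehler_heat_equation`). Even with polynomial factors it lies below a product of Gaussians, locally
uniformly in time (`exists_mehler_le`), so derivatives pass through the integral: in time by a
quadratic Taylor remainder in `L²` norm (`hasDerivAt_integralOp`), in space by transposing the
operator so that weak derivatives fall on the kernel (`IsDominated.operatorGraph`).

For the initial value, the Schur test bounds the operator norm by `e^{-lt}`, and rescaling turns the
kernel into a Gaussian density, so that `⟨φ, T_t φ⟩ → ‖φ‖²` for continuous `φ` of compact support.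
Together these force `T_t φ → φ` in norm, and density does the rest (`integralOp_mehler_tendsto`).

Two heat kernels represent the same solutions; testing on indicators of rational intervals shows
that they agree almost everywhere (`IsHeatKernel.ae_eq`), and continuity removes the exceptional
set. -/

theorem real_inner_eq_re_inner_L2 (u h : L2 𝕜) : inner ℝ u h = RCLike.re (inner 𝕜 u h) := by
  rw [L2.inner_def, L2.inner_def, ← integral_re (L2.integrable_inner u h)]
  rfl

theorem integrable_smul_of_memLp {φ : ℝ → ℝ} {v : ℝ → 𝕜} (hφ : MemLp φ 2) (hv : MemLp v 2) :
    Integrable (fun x => φ x • v x) :=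
  memLp_one_iff_integrable.1 (hv.smul hφ)

theorem memLp_coe (v : L2 𝕜) : MemLp v 2 (volume : Measure ℝ) := Lp.memLp v

theorem memLp_of_contDiff {φ : ℝ → ℝ} (h : ContDiff ℝ ∞ φ) (hc : HasCompactSupport φ) :
    MemLp φ 2 :=
  h.continuous.memLp_of_hasCompactSupport hc

theorem memLp_deriv_of_contDiff {φ : ℝ → ℝ} (h : ContDiff ℝ ∞ φ) (hc : HasCompactSupport φ) :
    MemLp (deriv φ) 2 :=
  (h.continuous_deriv (by simp)).memLp_of_hasCompactSupport hc.deriv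

theorem norm_sq_eq_integral (u : L2 𝕜) : ‖u‖ ^ 2 = ∫ x, ‖u x‖ ^ 2 := by
  rw [← real_inner_self_eq_norm_sq u, L2.inner_def]
  simp_rw [real_inner_self_eq_norm_sq]

theorem integrable_norm_sq (u : L2 𝕜) : Integrable fun x => ‖u x‖ ^ 2 :=
  (memLp_two_iff_integrable_sq_norm (Lp.aestronglyMeasurable u)).1 (memLp_coe u)

/-! ### Form domain, operator and uniqueness of solutions -/

theorem HasWeakDeriv.sub {u u' v v' : L2 𝕜} (hu : HasWeakDeriv u u') (hv : HasWeakDeriv v v') :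
    HasWeakDeriv (u - v) (u' - v') := by
  intro φ h hc
  have h1 : ∫ x, deriv φ x • (u - v : L2 𝕜) x
      = (∫ x, deriv φ x • u x) - ∫ x, deriv φ x • v x := by
    rw [← integral_sub (integrable_smul_of_memLp (memLp_deriv_of_contDiff h hc) (memLp_coe u))
      (integrable_smul_of_memLp (memLp_deriv_of_contDiff h hc) (memLp_coe v))]
    refine integral_congr_ae ?_
    filter_upwards [Lp.coeFn_sub u v] with x hx
    rw [hx, Pi.sub_apply, smul_sub]
  have h2 : ∫ x, φ x • (u' - v' : L2 𝕜) x = (∫ x, φ x • u' x) - ∫ x, φ x • v' x := by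
    rw [← integral_sub (integrable_smul_of_memLp (memLp_of_contDiff h hc) (memLp_coe u'))
      (integrable_smul_of_memLp (memLp_of_contDiff h hc) (memLp_coe v'))]
    refine integral_congr_ae ?_
    filter_upwards [Lp.coeFn_sub u' v'] with x hx
    rw [hx, Pi.sub_apply, smul_sub]
  rw [h1, h2, hu φ h hc, hv φ h hc]
  ring

theorem InFormDomain.sub {V : ℝ → ℝ} (hV : Continuous V) {u u' v v' : L2 𝕜}
    (hu : InFormDomain V u u') (hv : InFormDomain V v v') :
    InFormDomain V (u - v) (u' - v') := by
  refine ⟨hu.weakDeriv.sub hv.weakDeriv, ?_⟩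
  refine Integrable.mono' ((hu.potential.norm.add hv.potential.norm).const_mul 2)
    (hV.aestronglyMeasurable.mul ((Lp.aestronglyMeasurable _).norm.pow 2)) ?_
  filter_upwards [Lp.coeFn_sub u v] with x hx
  rw [hx]
  simp only [Pi.sub_apply, Pi.add_apply, norm_mul, norm_pow, norm_norm]
  have h1 := norm_sub_le (u x) (v x)
  have h2 : ‖u x - v x‖ ^ 2 ≤ 2 * (‖u x‖ ^ 2 + ‖v x‖ ^ 2) := by
    nlinarith [sq_nonneg (‖u x‖ - ‖v x‖), norm_nonneg (u x - v x)]
  nlinarith [norm_nonneg (V x), mul_le_mul_of_nonneg_left h2 (norm_nonneg (V x))]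

theorem InFormDomain.integrable_potential_inner {V : ℝ → ℝ} (hV : Continuous V)
    {u u' v v' : L2 𝕜} (hu : InFormDomain V u u') (hv : InFormDomain V v v') :
    Integrable (fun x => V x • inner 𝕜 (v x) (u x)) := by
  refine Integrable.mono' (hu.potential.norm.add hv.potential.norm)
    (hV.aestronglyMeasurable.smul
      ((Lp.aestronglyMeasurable v).inner (Lp.aestronglyMeasurable u))) ?_
  refine Eventually.of_forall fun x => ?_
  simp only [Pi.add_apply, norm_mul, norm_pow, norm_norm, norm_smul]
  have h1 := norm_inner_le_norm (𝕜 := 𝕜) (v x) (u x)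
  have h2 : ‖inner 𝕜 (v x) (u x)‖ ≤ ‖u x‖ ^ 2 + ‖v x‖ ^ 2 := by
    nlinarith [sq_nonneg (‖u x‖ - ‖v x‖), sq_nonneg (‖u x‖), sq_nonneg (‖v x‖)]
  nlinarith [mul_le_mul_of_nonneg_left h2 (norm_nonneg (V x))]

theorem InFormDomain.form_eq {V : ℝ → ℝ} (hV : Continuous V)
    {u u' v v' : L2 𝕜} (hu : InFormDomain V u u') (hv : InFormDomain V v v') :
    form V u u' v v' = inner 𝕜 v' u' + ∫ x, V x • inner 𝕜 (v x) (u x) := by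
  rw [form, integral_add (L2.integrable_inner v' u') (hu.integrable_potential_inner hV hv),
    L2.inner_def]

/-- Linearity of `H` makes the difference of two solutions a solution with initial value zero. -/
theorem OperatorGraph.sub {V : ℝ → ℝ} (hV : Continuous V) {u h v k : L2 𝕜}
    (hu : OperatorGraph V u h) (hv : OperatorGraph V v k) : OperatorGraph V (u - v) (h - k) := by
  obtain ⟨u', hu', hu⟩ := hu
  obtain ⟨v', hv', hv⟩ := hv
  refine ⟨u' - v', hu'.sub hV hv', fun w w' hw => ?_⟩
  have h1 : ∫ x, V x • inner 𝕜 (w x) ((u - v : L2 𝕜) x)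
      = (∫ x, V x • inner 𝕜 (w x) (u x)) - ∫ x, V x • inner 𝕜 (w x) (v x) := by
    rw [← integral_sub (hu'.integrable_potential_inner hV hw)
      (hv'.integrable_potential_inner hV hw)]
    refine integral_congr_ae ?_
    filter_upwards [Lp.coeFn_sub u v] with x hx
    rw [hx, Pi.sub_apply, inner_sub_right, smul_sub]
  rw [(hu'.sub hV hv').form_eq hV hw, inner_sub_right, inner_sub_right, ← hu w w' hw,
    ← hv w w' hw, hu'.form_eq hV hw, hv'.form_eq hV hw, h1]
  ring

/-- The operator is bounded below by any lower bound of the potential. -/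
theorem OperatorGraph.le_re_inner {V : ℝ → ℝ} (hV : Continuous V) {l : ℝ} (hl : ∀ x, l ≤ V x)
    {u h : L2 𝕜} (hu : OperatorGraph V u h) : l * ‖u‖ ^ 2 ≤ RCLike.re (inner 𝕜 u h) := by
  obtain ⟨u', hu', hu⟩ := hu
  rw [← hu u u' hu', hu'.form_eq hV hu', map_add,
    ← integral_re (hu'.integrable_potential_inner hV hu')]
  have h1 : l * ‖u‖ ^ 2 = ∫ x, l * ‖u x‖ ^ 2 := by
    rw [integral_const_mul, norm_sq_eq_integral]
  have h2 : ∀ x, RCLike.re (V x • inner 𝕜 (u x) (u x)) = V x * ‖u x‖ ^ 2 := by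
    intro x
    rw [RCLike.smul_re, inner_self_eq_norm_sq]
  simp_rw [h2]
  have h3 : ∫ x, l * ‖u x‖ ^ 2 ≤ ∫ x, V x * ‖u x‖ ^ 2 := by
    exact integral_mono ((integrable_norm_sq u).const_mul l) hu'.potential
      fun x => mul_le_mul_of_nonneg_right (hl x) (sq_nonneg _)
  have h4 : 0 ≤ RCLike.re (inner 𝕜 u' u') := inner_self_nonneg
  linarith

/-- Energy method: `w = u - v` satisfies `d/ds ‖w‖² = -2 Re⟨w, Hw⟩ ≤ -2l‖w‖²`. The weight `e^{2ls}`
absorbs the right-hand side whatever the sign of `l`. -/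
theorem IsHeatSolution.unique {V : ℝ → ℝ} (hV : Continuous V) {l : ℝ} (hl : ∀ x, l ≤ V x)
    {f : L2 𝕜} {u v : ℝ → L2 𝕜} (hu : IsHeatSolution V f u) (hv : IsHeatSolution V f v)
    {t : ℝ} (ht : 0 < t) : u t = v t := by
  have key : ∀ s : ℝ, 0 < s → ∃ d : ℝ, d ≤ 0 ∧
      HasDerivAt (fun s => Real.exp (2 * l * s) * ‖u s - v s‖ ^ 2) d s := by
    intro s hs
    obtain ⟨h, hg, hd⟩ := hu.equation s hs
    obtain ⟨k, kg, kd⟩ := hv.equation s hs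
    have e1 : HasDerivAt (fun s => u s - v s) (-(h - k)) s := by
      have := hd.sub kd
      rwa [show -h - -k = -(h - k) by abel] at this
    have e2 := (hg.sub hV kg).le_re_inner hV hl
    have e3 : HasDerivAt (fun s : ℝ => Real.exp (2 * l * s)) (Real.exp (2 * l * s) * (2 * l)) s := by
      simpa using ((hasDerivAt_id s).const_mul (2 * l)).exp
    refine ⟨_, ?_, e3.mul e1.norm_sq⟩
    -- The derivative of `‖·‖²` involves the real inner product, the lower bound `e2` the one over
    -- `𝕜`.
    rw [inner_neg_right, real_inner_eq_re_inner_L2]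
    nlinarith [Real.exp_pos (2 * l * s),
      mul_le_mul_of_nonneg_left e2 (Real.exp_pos (2 * l * s)).le]
  have anti : AntitoneOn (fun s => Real.exp (2 * l * s) * ‖u s - v s‖ ^ 2) (Set.Ioi 0) := by
    refine antitoneOn_of_deriv_nonpos (convex_Ioi 0) ?_ ?_ ?_
    · intro s hs
      obtain ⟨d, -, h⟩ := key s hs
      exact h.continuousAt.continuousWithinAt
    · rw [interior_Ioi]
      intro s hs
      obtain ⟨d, -, h⟩ := key s hs
      exact h.differentiableAt.differentiableWithinAt
    · rw [interior_Ioi]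
      intro s hs
      obtain ⟨d, h0, h⟩ := key s hs
      rwa [h.deriv]
  have lim : Tendsto (fun s => Real.exp (2 * l * s) * ‖u s - v s‖ ^ 2) (𝓝[>] 0) (𝓝 0) := by
    have e1 : Tendsto (fun s : ℝ => Real.exp (2 * l * s)) (𝓝[>] 0)
        (𝓝 (Real.exp (2 * l * 0))) := by
      refine Tendsto.mono_left (Continuous.tendsto ?_ 0) nhdsWithin_le_nhds
      fun_prop
    simpa using e1.mul (((hu.initial.sub hv.initial).norm).pow 2)
  have : Real.exp (2 * l * t) * ‖u t - v t‖ ^ 2 ≤ 0 := by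
    refine ge_of_tendsto lim ?_
    filter_upwards [Ioo_mem_nhdsGT ht] with s hs
    exact anti hs.1 ht hs.2.le
  have h0 : ‖u t - v t‖ ^ 2 ≤ 0 := by
    by_contra hneg
    exact absurd this (not_le.2 (mul_pos (Real.exp_pos _) (not_le.1 hneg)))
  exact sub_eq_zero.1 (norm_eq_zero.1 (by nlinarith [norm_nonneg (u t - v t)]))

/-! ### Test functions for weak derivatives -/

/-- Smooth square-integrable functions with square-integrable derivative are admissible as test
functions for the weak derivative. -/
theorem HasWeakDeriv.integral_deriv_smul {v v' : L2 𝕜} (hv : HasWeakDeriv v v')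
    {ψ : ℝ → ℝ} (hψ : ContDiff ℝ ∞ ψ) (h0 : MemLp ψ 2) (h1 : MemLp (deriv ψ) 2) :
    ∫ x, deriv ψ x • v x = -∫ x, ψ x • v' x := by
  -- The cutoff `χ(εx)` makes `ψ` an admissible test function. As `ε → 0` it tends to `1`, while the
  -- extra term `ε χ'(εx) ψ` of the product rule vanishes in the limit.
  let χ : ContDiffBump (0 : ℝ) := ⟨1, 2, one_pos, one_lt_two⟩
  have χs : ContDiff ℝ ∞ χ := χ.contDiff
  obtain ⟨B, hB⟩ : ∃ B, ∀ x, ‖deriv χ x‖ ≤ B :=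
    (χs.continuous_deriv (by simp)).bounded_above_of_compact_support χ.hasCompactSupport.deriv
  have hχ1 : ∀ x, ‖χ x‖ ≤ 1 := fun x => by
    rw [Real.norm_of_nonneg χ.nonneg]; exact χ.le_one
  have hB0 : 0 ≤ B := (norm_nonneg _).trans (hB 0)
  let ε : ℕ → ℝ := fun n => 1 / ((n : ℝ) + 1)
  have hε0 : ∀ n, 0 < ε n := fun n => by positivity
  have hε1 : ∀ n, ε n ≤ 1 := fun n => by
    rw [div_le_one (by positivity)]; simp
  have hε : Tendsto ε atTop (𝓝 0) := tendsto_one_div_add_atTop_nhds_zero_nat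
  have hχd : ∀ n x, HasDerivAt (fun x => χ (ε n * x)) (ε n * deriv χ (ε n * x)) x := by
    intro n x
    have e1 := (χs.differentiable (by simp) (ε n * x)).hasDerivAt
    have e2 : HasDerivAt (fun x => ε n * x) (ε n) x := by
      simpa using (hasDerivAt_id x).const_mul (ε n)
    exact e1.scomp x e2
  have hd : ∀ n x, deriv (fun x => χ (ε n * x) * ψ x) x
      = ε n * deriv χ (ε n * x) * ψ x + χ (ε n * x) * deriv ψ x := fun n x =>
    ((hχd n x).mul (hψ.differentiable (by simp) x).hasDerivAt).deriv
  have hlim : ∀ x, Tendsto (fun n => χ (ε n * x)) atTop (𝓝 1) := by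
    intro x
    have : Tendsto (fun n => ε n * x) atTop (𝓝 (0 * x)) := hε.mul_const x
    rw [zero_mul] at this
    have e := (χ.continuous.tendsto 0).comp this
    rwa [χ.one_of_mem_closedBall (by simp [χ])] at e
  have hcut : ∀ n, ContDiff ℝ ∞ fun x => χ (ε n * x) * ψ x := fun n =>
    (χs.comp (contDiff_const.mul contDiff_id)).mul hψ
  have hcs : ∀ n, HasCompactSupport fun x => χ (ε n * x) * ψ x := by
    intro n
    have : HasCompactSupport fun x => χ (ε n * x) :=
      χ.hasCompactSupport.comp_homeomorph (Homeomorph.mulLeft₀ (ε n) (hε0 n).ne')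
    exact this.mul_right
  have key : ∀ n, ∫ x, (ε n * deriv χ (ε n * x) * ψ x + χ (ε n * x) * deriv ψ x) • v x
      = -∫ x, (χ (ε n * x) * ψ x) • v' x := by
    intro n
    have := hv _ (hcut n) (hcs n)
    simpa only [hd] using this
  have i0 := integrable_smul_of_memLp h0 (memLp_coe v)
  have i1 := integrable_smul_of_memLp h1 (memLp_coe v)
  have i2 := integrable_smul_of_memLp h0 (memLp_coe v')
  have hm : ∀ n, Continuous fun x => χ (ε n * x) := fun n =>
    χ.continuous.comp (continuous_const.mul continuous_id)
  have hm' : ∀ n, Continuous fun x => deriv χ (ε n * x) := fun n =>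
    (χs.continuous_deriv (by simp)).comp (continuous_const.mul continuous_id)
  have L1 : Tendsto (fun n => ∫ x, (ε n * deriv χ (ε n * x) * ψ x + χ (ε n * x) * deriv ψ x) • v x)
      atTop (𝓝 (∫ x, deriv ψ x • v x)) := by
    refine tendsto_integral_of_dominated_convergence
      (fun x => B * ‖ψ x • v x‖ + ‖deriv ψ x • v x‖) ?_ ((i0.norm.const_mul B).add i1.norm) ?_ ?_
    · intro n
      refine AEStronglyMeasurable.smul (Continuous.aestronglyMeasurable ?_)
        (Lp.aestronglyMeasurable v)
      exact ((continuous_const.mul (hm' n)).mul hψ.continuous).add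
        ((hm n).mul (hψ.continuous_deriv (by simp)))
    · intro n
      refine Eventually.of_forall fun x => ?_
      rw [add_smul, mul_smul, mul_smul (χ (ε n * x))]
      refine (norm_add_le _ _).trans (add_le_add ?_ ?_)
      · rw [norm_smul]
        refine mul_le_mul_of_nonneg_right ?_ (norm_nonneg _)
        rw [norm_mul, Real.norm_of_nonneg (hε0 n).le]
        exact (mul_le_mul (hε1 n) (hB _) (norm_nonneg _) zero_le_one).trans (one_mul B).le
      · rw [norm_smul]
        exact mul_le_of_le_one_left (norm_nonneg _) (hχ1 _)
    · refine Eventually.of_forall fun x => ?_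
      have e0 : Tendsto (fun n => ε n * deriv χ (ε n * x)) atTop (𝓝 0) := by
        refine squeeze_zero_norm (a := fun n => ε n * B) (fun n => ?_)
          (by simpa using hε.mul_const B)
        rw [norm_mul, Real.norm_of_nonneg (hε0 n).le]
        exact mul_le_mul_of_nonneg_left (hB _) (hε0 n).le
      have e1 := ((e0.mul_const (ψ x)).add ((hlim x).mul_const (deriv ψ x))).smul_const (v x)
      simpa using e1
  have L2 : Tendsto (fun n => -∫ x, (χ (ε n * x) * ψ x) • v' x)
      atTop (𝓝 (-∫ x, ψ x • v' x)) := by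
    refine (tendsto_integral_of_dominated_convergence (fun x => ‖ψ x • v' x‖) ?_ i2.norm ?_ ?_).neg
    · intro n
      exact AEStronglyMeasurable.smul ((hm n).mul hψ.continuous).aestronglyMeasurable
        (Lp.aestronglyMeasurable v')
    · intro n
      refine Eventually.of_forall fun x => ?_
      rw [mul_smul, norm_smul]
      exact mul_le_of_le_one_left (norm_nonneg _) (hχ1 _)
    · refine Eventually.of_forall fun x => ?_
      simpa using ((hlim x).mul_const (ψ x)).smul_const (v' x)
  simp_rw [key] at L1
  exact tendsto_nhds_unique L1 L2

/-- Smooth compactly supported functions, as elements of `L²`, have their classical derivative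
as weak derivative. -/
theorem hasWeakDeriv_ofReal {φ : ℝ → ℝ} (h : ContDiff ℝ ∞ φ) (hc : HasCompactSupport φ) :
    HasWeakDeriv (MemLp.toLp _ (memLp_of_contDiff h hc).ofReal : L2 𝕜)
      (MemLp.toLp _ (memLp_deriv_of_contDiff h hc).ofReal) := by
  intro ψ hψ hψc
  have e1 : ∫ x, deriv ψ x • (MemLp.toLp _ (memLp_of_contDiff h hc).ofReal : L2 𝕜) x
      = ((∫ x, φ x * deriv ψ x : ℝ) : 𝕜) := by
    rw [← integral_ofReal]
    refine integral_congr_ae ?_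
    filter_upwards [(memLp_of_contDiff h hc).ofReal (K := 𝕜).coeFn_toLp] with x hx
    rw [hx, RCLike.real_smul_eq_coe_mul, RCLike.ofReal_mul, mul_comm]
  have e2 : ∫ x, ψ x • (MemLp.toLp _ (memLp_deriv_of_contDiff h hc).ofReal : L2 𝕜) x
      = ((∫ x, deriv φ x * ψ x : ℝ) : 𝕜) := by
    rw [← integral_ofReal]
    refine integral_congr_ae ?_
    filter_upwards [(memLp_deriv_of_contDiff h hc).ofReal (K := 𝕜).coeFn_toLp] with x hx
    rw [hx, RCLike.real_smul_eq_coe_mul, RCLike.ofReal_mul, mul_comm]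
  rw [e1, e2, integral_mul_deriv_eq_deriv_mul_of_integrable (u' := deriv φ)
    (fun x _ => (h.differentiable (by simp) x).hasDerivAt)
    (fun x _ => (hψ.differentiable (by simp) x).hasDerivAt), RCLike.ofReal_neg]
  · exact (memLp_of_contDiff h hc).integrable_mul (memLp_deriv_of_contDiff hψ hψc)
  · exact (memLp_deriv_of_contDiff h hc).integrable_mul (memLp_of_contDiff hψ hψc)
  · exact (memLp_of_contDiff h hc).integrable_mul (memLp_of_contDiff hψ hψc)

/-! ### Integral operators with dominated kernels -/

/-- The continuous kernel `K` is bounded by a multiple of the product kernel `g(x) g(y)`. -/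
structure IsDominated (g : ℝ → ℝ) (C : ℝ) (K : ℝ → ℝ → ℝ) : Prop where
  continuous : Continuous (Function.uncurry K)
  bound : ∀ x y, |K x y| ≤ C * (g x * g y)

open Classical in
/-- The integral operator with kernel `K`, where it maps into `L²`. -/
def integralOp (K : ℝ → ℝ → ℝ) (f : L2 𝕜) : L2 𝕜 :=
  if h : MemLp (fun x => ∫ y, K x y • f y) 2 (volume : Measure ℝ) then h.toLp else 0

theorem coeFn_integralOp {K : ℝ → ℝ → ℝ} {f : L2 𝕜}
    (h : MemLp (fun x => ∫ y, K x y • f y) 2 (volume : Measure ℝ)) :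
    ∀ᵐ x, integralOp K f x = ∫ y, K x y • f y := by
  rw [integralOp, dif_pos h]
  exact h.coeFn_toLp

section

variable {g : ℝ → ℝ} {C : ℝ} {K : ℝ → ℝ → ℝ}

theorem IsDominated.memLp_left (hK : IsDominated g C K) (hg : MemLp g 2) (x : ℝ) :
    MemLp (fun y => K x y) 2 := by
  refine hg.of_le_mul (c := |C * g x|) (Continuous.aestronglyMeasurable ?_)
    (Eventually.of_forall fun y => ?_)
  · exact hK.continuous.comp (continuous_const.prodMk continuous_id)
  · rw [Real.norm_eq_abs, Real.norm_eq_abs, ← abs_mul, mul_assoc]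
    exact (hK.bound x y).trans (le_abs_self _)

theorem IsDominated.memLp_right (hK : IsDominated g C K) (hg : MemLp g 2) (y : ℝ) :
    MemLp (fun x => K x y) 2 := by
  refine hg.of_le_mul (c := |C * g y|) (Continuous.aestronglyMeasurable ?_)
    (Eventually.of_forall fun x => ?_)
  · exact hK.continuous.comp (continuous_id.prodMk continuous_const)
  · rw [Real.norm_eq_abs, Real.norm_eq_abs, ← abs_mul, mul_assoc, mul_comm (g y)]
    exact (hK.bound x y).trans (le_abs_self _)

theorem IsDominated.integrable_smul (hK : IsDominated g C K) (hg : MemLp g 2) (f : L2 𝕜)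
    (x : ℝ) : Integrable fun y => K x y • f y :=
  integrable_smul_of_memLp (hK.memLp_left hg x) (memLp_coe f)

theorem aestronglyMeasurable_integral_smul (hK : Continuous (Function.uncurry K)) (f : L2 𝕜) :
    AEStronglyMeasurable (fun x => ∫ y, K x y • f y) (volume : Measure ℝ) := by
  have h : AEStronglyMeasurable (fun z : ℝ × ℝ => K z.1 z.2 • f z.2)
      ((volume : Measure ℝ).prod volume) :=
    hK.aestronglyMeasurable.smul (Lp.aestronglyMeasurable f).comp_snd
  exact h.integral_prod_right'

/-- The dominating kernel has rank one, so the image of `f` lies pointwise below a multiple of `g`.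
Both membership in `L²` and the norm bound follow from this. -/
theorem IsDominated.norm_integral_le (hK : IsDominated g C K) (hg : MemLp g 2) (f : L2 𝕜)
    (x : ℝ) : ‖∫ y, K x y • f y‖ ≤ C * (∫ y, g y * ‖f y‖) * g x := by
  have hi : Integrable fun y => g y * ‖f y‖ :=
    hg.integrable_mul (memLp_coe f).norm
  refine (norm_integral_le_integral_norm _).trans ?_
  rw [show C * (∫ y, g y * ‖f y‖) * g x = ∫ y, C * g x * (g y * ‖f y‖) by
    rw [integral_const_mul]; ring]
  refine integral_mono (hK.integrable_smul hg f x).norm (hi.const_mul _) fun y => ?_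
  simp only [norm_smul, Real.norm_eq_abs]
  have := mul_le_mul_of_nonneg_right (hK.bound x y) (norm_nonneg (f y))
  linarith

theorem IsDominated.memLp (hK : IsDominated g C K) (hg : MemLp g 2) (f : L2 𝕜) :
    MemLp (fun x => ∫ y, K x y • f y) 2 (volume : Measure ℝ) := by
  refine hg.of_le_mul (c := |C * ∫ y, g y * ‖f y‖|)
    (aestronglyMeasurable_integral_smul hK.continuous f)
    (Eventually.of_forall fun x => ?_)
  rw [Real.norm_eq_abs, ← abs_mul]
  exact (hK.norm_integral_le hg f x).trans (le_abs_self _)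

theorem IsDominated.coeFn (hK : IsDominated g C K) (hg : MemLp g 2) (f : L2 𝕜) :
    ∀ᵐ x, integralOp K f x = ∫ y, K x y • f y :=
  coeFn_integralOp (hK.memLp hg f)

theorem IsDominated.norm_integralOp_le (hK : IsDominated g C K) (hg : MemLp g 2)
    (hg0 : ∀ x, 0 ≤ g x) (f : L2 𝕜) :
    ‖integralOp K f‖ ≤ C * ((∫ y, g y * ‖f y‖) * ‖hg.toLp g‖) := by
  rw [← mul_assoc]
  refine Lp.norm_le_mul_norm_of_ae_le_mul ?_
  filter_upwards [hK.coeFn hg f, hg.coeFn_toLp] with x h1 h2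
  rw [h1, h2, Real.norm_of_nonneg (hg0 x)]
  exact hK.norm_integral_le hg f x

/-- The adjoint of an integral operator has the transposed kernel. -/
theorem IsDominated.integral_inner (hK : IsDominated g C K) (hg : MemLp g 2) (v f : L2 𝕜) :
    ∫ x, inner 𝕜 (v x) (integralOp K f x) = ∫ y, inner 𝕜 (∫ x, K x y • v x) (f y) := by
  have h1 : ∫ x, inner 𝕜 (v x) (integralOp K f x)
      = ∫ x, ∫ y, inner 𝕜 (v x) (K x y • f y) := by
    refine integral_congr_ae ?_
    filter_upwards [hK.coeFn hg f] with x hx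
    rw [hx, _root_.integral_inner (hK.integrable_smul hg f x)]
  rw [h1, integral_integral_swap]
  · refine integral_congr_ae (Eventually.of_forall fun y => ?_)
    have hi : Integrable fun x => K x y • v x :=
      integrable_smul_of_memLp (hK.memLp_right hg y) (memLp_coe v)
    have e := _root_.integral_inner (𝕜 := 𝕜) hi (f y)
    simp only
    rw [← inner_conj_symm, ← e, ← integral_conj]
    refine integral_congr_ae (Eventually.of_forall fun x => ?_)
    simp only [RCLike.real_smul_eq_coe_smul (K := 𝕜), inner_smul_right, map_mul,
      RCLike.conj_ofReal]
    rw [inner_conj_symm]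
  -- Fubini is justified by the product majorant `C · g(x)‖v(x)‖ · g(y)‖f(y)‖`.
  · have hi1 : Integrable fun y => g y * ‖f y‖ := hg.integrable_mul (memLp_coe f).norm
    have hi2 : Integrable fun y => g y * ‖v y‖ := hg.integrable_mul (memLp_coe v).norm
    refine Integrable.mono' ((hi2.mul_prod hi1).const_mul C) ?_ ?_
    · exact (Lp.aestronglyMeasurable v).comp_fst.inner
        (hK.continuous.aestronglyMeasurable.smul (Lp.aestronglyMeasurable f).comp_snd)
    · refine Eventually.of_forall fun z => ?_
      simp only [Function.uncurry]
      refine (norm_inner_le_norm _ _).trans ?_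
      rw [norm_smul, Real.norm_eq_abs]
      have := mul_le_mul_of_nonneg_right (hK.bound z.1 z.2)
        (mul_nonneg (norm_nonneg (v z.1)) (norm_nonneg (f z.2)))
      linarith

/-- Differentiating the kernel in its first variable moves the weak derivative. -/
theorem IsDominated.integral_inner_deriv {K' : ℝ → ℝ → ℝ} {C' : ℝ}
    (hK : IsDominated g C K) (hK' : IsDominated g C' K') (hg : MemLp g 2)
    (hs : ∀ y, ContDiff ℝ ∞ fun x => K x y) (hd : ∀ y x, HasDerivAt (fun x => K x y) (K' x y) x)
    {v v' : L2 𝕜} (hv : HasWeakDeriv v v') (f : L2 𝕜) :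
    ∫ x, inner 𝕜 (v' x) (integralOp K f x) = -∫ x, inner 𝕜 (v x) (integralOp K' f x) := by
  -- After transposition, `x ↦ K x y` with `y` fixed plays the role of the test function; it need
  -- not have compact support, hence `integral_deriv_smul`.
  rw [hK.integral_inner hg, hK'.integral_inner hg, ← integral_neg]
  refine integral_congr_ae (Eventually.of_forall fun y => ?_)
  have hdd : deriv (fun x => K x y) = fun x => K' x y := funext fun x => (hd y x).deriv
  have := hv.integral_deriv_smul (hs y) (hK.memLp_right hg y)
    (by rw [hdd]; exact hK'.memLp_right hg y)
  rw [hdd] at this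
  simp only
  rw [this, inner_neg_left, neg_neg]

theorem inner_ofReal_left (r : ℝ) (z : 𝕜) : inner 𝕜 (r : 𝕜) z = r • z := by
  rw [RCLike.inner_apply, RCLike.conj_ofReal, RCLike.real_smul_eq_coe_mul, mul_comm]

/-- Duality: a test function, viewed in `L²`, has a weak derivative itself, and
`integral_inner_deriv` applied to it is the defining identity. -/
theorem IsDominated.hasWeakDeriv {K' : ℝ → ℝ → ℝ} {C' : ℝ}
    (hK : IsDominated g C K) (hK' : IsDominated g C' K') (hg : MemLp g 2)
    (hs : ∀ y, ContDiff ℝ ∞ fun x => K x y) (hd : ∀ y x, HasDerivAt (fun x => K x y) (K' x y) x)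
    (f : L2 𝕜) : HasWeakDeriv (integralOp K f) (integralOp K' f) := by
  intro φ h hc
  have := hK.integral_inner_deriv hK' hg hs hd (hasWeakDeriv_ofReal (𝕜 := 𝕜) h hc) f
  convert this using 1
  · refine integral_congr_ae ?_
    filter_upwards [(memLp_deriv_of_contDiff h hc).ofReal (K := 𝕜).coeFn_toLp] with x hx
    rw [hx, inner_ofReal_left]
  · congr 1
    refine integral_congr_ae ?_
    filter_upwards [(memLp_of_contDiff h hc).ofReal (K := 𝕜).coeFn_toLp] with x hx
    rw [hx, inner_ofReal_left]

/-- If the kernel satisfies `∂ₓ² K - V K = L`, then its integral operator maps into the domain of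
`-d²/dx² + V`, and the composition is the operator with kernel `-L`. -/
theorem IsDominated.operatorGraph {K₁ K₂ L : ℝ → ℝ → ℝ} {C₁ C₂ D : ℝ} {V : ℝ → ℝ}
    (hV : Continuous V) (hg : MemLp g 2)
    (hK : IsDominated g C K) (hK₁ : IsDominated g C₁ K₁) (hK₂ : IsDominated g C₂ K₂)
    (hL : IsDominated g D L)
    (hs : ∀ y, ContDiff ℝ ∞ fun x => K x y) (hs₁ : ∀ y, ContDiff ℝ ∞ fun x => K₁ x y)
    (hd : ∀ y x, HasDerivAt (fun x => K x y) (K₁ x y) x)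
    (hd₁ : ∀ y x, HasDerivAt (fun x => K₁ x y) (K₂ x y) x)
    (hVK : ∀ x y, K₂ x y - V x * K x y = L x y) (f : L2 𝕜) :
    OperatorGraph V (integralOp K f) (-integralOp L f) := by
  -- Integrating `V K = K₂ - L` against `f` shows that `V u` is in `L²`. Thus `V|u|²` is integrable
  -- as a product of two square-integrable functions.
  have hmul : ∀ᵐ x, V x • integralOp K f x = integralOp K₂ f x - integralOp L f x := by
    filter_upwards [hK.coeFn hg f, hK₂.coeFn hg f, hL.coeFn hg f] with x h h2 h3
    rw [h, h2, h3, ← integral_smul, ← integral_sub (hK₂.integrable_smul hg f x)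
      (hL.integrable_smul hg f x)]
    refine integral_congr_ae (Eventually.of_forall fun y => ?_)
    simp only
    rw [← hVK, ← sub_smul, sub_sub_cancel, mul_smul]
  have hdom : InFormDomain V (integralOp K f) (integralOp K₁ f) := by
    refine ⟨hK.hasWeakDeriv hK₁ hg hs hd f, ?_⟩
    have hi : Integrable fun x =>
        ‖(integralOp K₂ f - integralOp L f : L2 𝕜) x‖ * ‖integralOp K f x‖ :=
      (memLp_coe _).norm.integrable_mul (memLp_coe _).norm
    refine hi.mono' (hV.aestronglyMeasurable.mul ((Lp.aestronglyMeasurable _).norm.pow 2)) ?_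
    filter_upwards [hmul, Lp.coeFn_sub (integralOp K₂ f) (integralOp L f)] with x h1 h2
    rw [h2, Pi.sub_apply, ← h1, norm_smul, norm_mul, norm_pow, norm_norm]
    exact le_of_eq (by ring)
  refine ⟨_, hdom, fun v v' hv => ?_⟩
  rw [hdom.form_eq hV hv, L2.inner_def, hK₁.integral_inner_deriv hK₂ hg hs₁ hd₁ hv.weakDeriv f,
    ← L2.inner_def, inner_neg_right]
  have h2 : ∫ x, V x • inner 𝕜 (v x) (integralOp K f x)
      = inner 𝕜 v (integralOp K₂ f) - inner 𝕜 v (integralOp L f) := by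
    rw [← inner_sub_right, L2.inner_def]
    refine integral_congr_ae ?_
    filter_upwards [hmul, Lp.coeFn_sub (integralOp K₂ f) (integralOp L f)] with x h1 h2
    rw [h2, Pi.sub_apply, ← h1]
    simp only [RCLike.real_smul_eq_coe_smul (K := 𝕜), inner_smul_right]
    rw [smul_eq_mul]
  rw [h2]
  ring

end

/-- A kernel whose second derivative in time is locally uniformly dominated generates an
operator that is differentiable in time. -/
theorem hasDerivAt_integralOp {g : ℝ → ℝ} {K K' K'' : ℝ → ℝ → ℝ → ℝ} {a b C C₁ C' : ℝ} {t : ℝ}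
    (ht : t ∈ Set.Ioo a b) (hg : MemLp g 2) (hg0 : ∀ x, 0 ≤ g x)
    (hK : ∀ s ∈ Set.Ioo a b, IsDominated g C (K s))
    (hK' : ∀ s ∈ Set.Ioo a b, IsDominated g C₁ (K' s))
    (hb : ∀ s ∈ Set.Ioo a b, ∀ x y, |K'' s x y| ≤ C' * (g x * g y))
    (hd : ∀ s ∈ Set.Ioo a b, ∀ x y, HasDerivAt (fun s => K s x y) (K' s x y) s)
    (hd' : ∀ s ∈ Set.Ioo a b, ∀ x y, HasDerivAt (fun s => K' s x y) (K'' s x y) s)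
    (f : L2 𝕜) :
    HasDerivAt (fun s => integralOp (K s) f) (integralOp (K' t) f) t := by
  -- The mean value inequality, applied to `K'` and then to `K` minus its tangent at `t`, gives a
  -- quadratic remainder; the factor `1/2` of Taylor's formula is not needed.
  have taylor1 : ∀ s ∈ Set.Ioo a b, ∀ x y,
      |K' s x y - K' t x y| ≤ C' * (g x * g y) * |s - t| := fun s hs x y =>
    (convex_Ioo a b).norm_image_sub_le_of_norm_hasDerivWithin_le
      (fun r hr => (hd' r hr x y).hasDerivWithinAt) (fun r hr => hb r hr x y) ht hs
  have taylor : ∀ s ∈ Set.Ioo a b, ∀ x y,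
      |K s x y - K t x y - (s - t) * K' t x y| ≤ C' * |s - t| ^ 2 * (g x * g y) := by
    intro s hs x y
    have hsub : Set.uIcc t s ⊆ Set.Ioo a b := (Set.ordConnected_Ioo).uIcc_subset ht hs
    have := (convex_uIcc t s).norm_image_sub_le_of_norm_hasDerivWithin_le
      (f := fun r => K r x y - (r - t) * K' t x y) (f' := fun r => K' r x y - K' t x y)
      (C := C' * (g x * g y) * |s - t|) (x := t) (y := s)
      (fun r hr => by
        have e := (hd r (hsub hr) x y).sub
          (((hasDerivAt_id r).sub_const t).mul_const (K' t x y))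
        rw [one_mul] at e
        exact e.hasDerivWithinAt)
      (fun r hr => by
        refine (taylor1 r (hsub hr) x y).trans (mul_le_mul_of_nonneg_left
          (Set.abs_sub_left_of_mem_uIcc hr) ?_)
        exact (abs_nonneg _).trans (hb t ht x y))
      Set.left_mem_uIcc Set.right_mem_uIcc
    simp only [sub_self, zero_mul, sub_zero, Real.norm_eq_abs] at this
    calc _ = |K s x y - (s - t) * K' t x y - K t x y| := by congr 1; ring
      _ ≤ _ := this
      _ = _ := by ring
  have rem : ∀ s ∈ Set.Ioo a b,
      ‖integralOp (K s) f - integralOp (K t) f - (s - t) • integralOp (K' t) f‖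
        ≤ C' * ((∫ y, g y * ‖f y‖) * ‖hg.toLp g‖) * ‖s - t‖ ^ 2 := by
    intro s hs
    have hdom : IsDominated g (C' * |s - t| ^ 2)
        (fun x y => K s x y - K t x y - (s - t) * K' t x y) :=
      ⟨((hK s hs).continuous.sub (hK t ht).continuous).sub
        (continuous_const.mul (hK' t ht).continuous), taylor s hs⟩
    -- The remainder is again an integral operator with dominated kernel, so its norm is at most a
    -- constant times `|s - t|²`.
    have heq : integralOp (K s) f - integralOp (K t) f - (s - t) • integralOp (K' t) f
        = integralOp (fun x y => K s x y - K t x y - (s - t) * K' t x y) f := by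
      refine Lp.ext ?_
      filter_upwards [hdom.coeFn hg f, (hK s hs).coeFn hg f, (hK t ht).coeFn hg f,
        (hK' t ht).coeFn hg f, Lp.coeFn_sub (integralOp (K s) f - integralOp (K t) f)
          ((s - t) • integralOp (K' t) f), Lp.coeFn_sub (integralOp (K s) f) (integralOp (K t) f),
        Lp.coeFn_smul (s - t) (integralOp (K' t) f)] with x h1 h2 h3 h4 h5 h6 h7
      rw [h5, Pi.sub_apply, h6, h7, Pi.sub_apply, Pi.smul_apply, h1, h2, h3, h4, ← integral_smul,
        ← integral_sub ((hK s hs).integrable_smul hg f x) ((hK t ht).integrable_smul hg f x),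
        ← integral_sub (f := fun y => K s x y • f y - K t x y • f y)
          (g := fun y => (s - t) • K' t x y • f y)
          (((hK s hs).integrable_smul hg f x).sub ((hK t ht).integrable_smul hg f x))
          (((hK' t ht).integrable_smul hg f x).smul (s - t))]
      refine integral_congr_ae (Eventually.of_forall fun y => ?_)
      simp only [sub_smul, mul_smul]
    rw [heq]
    refine (hdom.norm_integralOp_le hg hg0 f).trans (le_of_eq ?_)
    rw [Real.norm_eq_abs]
    ring
  rw [hasDerivAt_iff_isLittleO]
  refine Asymptotics.IsBigO.trans_isLittleO (g := fun s => ‖s - t‖ ^ 2) ?_ ?_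
  · refine Asymptotics.IsBigO.of_bound (C' * ((∫ y, g y * ‖f y‖) * ‖hg.toLp g‖)) ?_
    filter_upwards [Ioo_mem_nhds ht.1 ht.2] with s hs
    rw [norm_pow, norm_norm]
    exact rem s hs
  · have h0 : Tendsto (fun s : ℝ => s - t) (𝓝 t) (𝓝 0) := by
      simpa using (continuous_sub_right t).tendsto t
    exact (Asymptotics.isLittleO_norm_pow_id (E' := ℝ) one_lt_two).comp_tendsto h0

/-! ### Hyperbolic functions and derivatives of the Mehler kernel -/

theorem csch_pos {s : ℝ} (hs : 0 < s) : 0 < csch s :=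
  one_div_pos.2 (Real.sinh_pos_iff.2 hs)

theorem coth_sq_sub_one {s : ℝ} (hs : 0 < s) : coth s ^ 2 - 1 = csch s ^ 2 := by
  have h := (Real.sinh_pos_iff.2 hs).ne'
  rw [coth, csch]
  field_simp
  rw [Real.cosh_sq]
  ring

theorem csch_lt_coth {s : ℝ} (hs : 0 < s) : csch s < coth s :=
  div_lt_div_of_pos_right (Real.one_lt_cosh.2 hs.ne') (Real.sinh_pos_iff.2 hs)

theorem hasDerivAt_csch {s : ℝ} (hs : 0 < s) : HasDerivAt csch (-(csch s * coth s)) s := by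
  have h := (Real.sinh_pos_iff.2 hs).ne'
  have := (hasDerivAt_const s (1 : ℝ)).div (Real.hasDerivAt_sinh s) h
  refine this.congr_deriv ?_
  rw [coth, csch]
  field_simp
  ring

theorem hasDerivAt_coth {s : ℝ} (hs : 0 < s) : HasDerivAt coth (-(csch s ^ 2)) s := by
  have h := (Real.sinh_pos_iff.2 hs).ne'
  have := (Real.hasDerivAt_cosh s).div (Real.hasDerivAt_sinh s) h
  refine this.congr_deriv ?_
  have e := Real.cosh_sq s
  rw [csch]
  field_simp
  linarith

/-- The heat kernel of `-d²/dx² + c² (x + b)² + l`. -/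
def mehler (c b l t x y : ℝ) : ℝ :=
  √(c * csch (2 * c * t) / (2 * Real.pi)) * Real.exp (-l * t)
    * Real.exp (-(c / 2) * (((x + b) ^ 2 + (y + b) ^ 2) * coth (2 * c * t)
        - 2 * ((x + b) * (y + b)) * csch (2 * c * t)))

/-- The logarithmic derivative of `mehler` in `t`. -/
def mehlerRate (c b l t x y : ℝ) : ℝ :=
  (-(c * coth (2 * c * t)) - l)
    + c ^ 2 * csch (2 * c * t) ^ 2 * ((x + b) ^ 2 + (y + b) ^ 2)
    + -(2 * c ^ 2 * (csch (2 * c * t) * coth (2 * c * t))) * ((x + b) * (y + b))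

/-- The derivative of `mehlerRate` in `t`. -/
def mehlerRateDeriv (c b t x y : ℝ) : ℝ :=
  2 * c ^ 2 * csch (2 * c * t) ^ 2
    + -(4 * c ^ 3 * (csch (2 * c * t) ^ 2 * coth (2 * c * t))) * ((x + b) ^ 2 + (y + b) ^ 2)
    + 4 * c ^ 3 * (csch (2 * c * t) * coth (2 * c * t) ^ 2 + csch (2 * c * t) ^ 3)
      * ((x + b) * (y + b))

/-- The logarithmic derivative of `mehler` in `x`. -/
def mehlerSlope (c b t x y : ℝ) : ℝ :=
  -(c * ((x + b) * coth (2 * c * t) - (y + b) * csch (2 * c * t)))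

section

variable {c b l t : ℝ}

theorem hasDerivAt_csch_two_mul (hc : 0 < c) (ht : 0 < t) :
    HasDerivAt (fun t => csch (2 * c * t))
      (-(2 * c * (csch (2 * c * t) * coth (2 * c * t)))) t := by
  have h2 : HasDerivAt (fun t => 2 * c * t) (2 * c) t := by
    simpa using (hasDerivAt_id t).const_mul (2 * c)
  refine ((hasDerivAt_csch (s := 2 * c * t) (by positivity)).comp t h2).congr_deriv ?_
  ring

theorem hasDerivAt_coth_two_mul (hc : 0 < c) (ht : 0 < t) :
    HasDerivAt (fun t => coth (2 * c * t)) (-(2 * c * csch (2 * c * t) ^ 2)) t := by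
  have h2 : HasDerivAt (fun t => 2 * c * t) (2 * c) t := by
    simpa using (hasDerivAt_id t).const_mul (2 * c)
  refine ((hasDerivAt_coth (s := 2 * c * t) (by positivity)).comp t h2).congr_deriv ?_
  ring

theorem continuousOn_csch_two_mul (hc : 0 < c) :
    ContinuousOn (fun t => csch (2 * c * t)) (Set.Ioi 0) := fun _ ht =>
  (hasDerivAt_csch_two_mul hc ht).continuousAt.continuousWithinAt

theorem continuousOn_coth_two_mul (hc : 0 < c) :
    ContinuousOn (fun t => coth (2 * c * t)) (Set.Ioi 0) := fun _ ht =>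
  (hasDerivAt_coth_two_mul hc ht).continuousAt.continuousWithinAt

theorem mehler_nonneg (x y : ℝ) : 0 ≤ mehler c b l t x y := by
  rw [mehler]; positivity

theorem continuous_mehler : Continuous (Function.uncurry (mehler c b l t)) := by
  unfold mehler Function.uncurry; fun_prop

theorem hasDerivAt_mehler_time (hc : 0 < c) (ht : 0 < t) (x y : ℝ) :
    HasDerivAt (fun t => mehler c b l t x y)
      (mehlerRate c b l t x y * mehler c b l t x y) t := by
  have hcs := csch_pos (s := 2 * c * t) (by positivity)
  have d1 := hasDerivAt_csch_two_mul hc ht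
  have d2 := hasDerivAt_coth_two_mul hc ht
  have hpos : 0 < c * csch (2 * c * t) / (2 * Real.pi) := by positivity
  have e1 := ((d1.const_mul c).div_const (2 * Real.pi)).sqrt hpos.ne'
  have e2 : HasDerivAt (fun t => Real.exp (-l * t)) (Real.exp (-l * t) * (-l)) t := by
    simpa using ((hasDerivAt_id t).const_mul (-l)).exp
  have e3 := (((d2.const_mul ((x + b) ^ 2 + (y + b) ^ 2)).sub
    (d1.const_mul (2 * ((x + b) * (y + b))))).const_mul (-(c / 2))).exp
  refine ((e1.mul e2).mul e3).congr_deriv ?_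
  -- The square-root prefactor has logarithmic derivative `-c coth(2ct)`, the leading term of
  -- `mehlerRate`.
  have e4 : c * -(2 * c * (csch (2 * c * t) * coth (2 * c * t))) / (2 * Real.pi)
      / (2 * √(c * csch (2 * c * t) / (2 * Real.pi)))
      = -(c * coth (2 * c * t)) * √(c * csch (2 * c * t) / (2 * Real.pi)) := by
    rw [div_eq_iff (by positivity)]
    have := Real.mul_self_sqrt hpos.le
    calc _ = -(2 * c * coth (2 * c * t)) * (c * csch (2 * c * t) / (2 * Real.pi)) := by ring
      _ = _ := by linear_combination 2 * c * coth (2 * c * t) * this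
  rw [e4, mehlerRate, mehler]
  simp only [Pi.mul_apply, Pi.sub_apply]
  ring

theorem hasDerivAt_mehlerRate (hc : 0 < c) (ht : 0 < t) (x y : ℝ) :
    HasDerivAt (fun t => mehlerRate c b l t x y) (mehlerRateDeriv c b t x y) t := by
  have d1 := hasDerivAt_csch_two_mul hc ht
  have d2 := hasDerivAt_coth_two_mul hc ht
  refine (((((d2.const_mul c).neg.sub_const l)).add
    (((d1.pow 2).const_mul (c ^ 2)).mul_const ((x + b) ^ 2 + (y + b) ^ 2))).add
    ((((d1.mul d2).const_mul (2 * c ^ 2)).neg).mul_const ((x + b) * (y + b)))).congr_deriv ?_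
  rw [mehlerRateDeriv]
  simp only [Nat.cast_ofNat]
  ring

theorem hasDerivAt_mehler_time_time (hc : 0 < c) (ht : 0 < t) (x y : ℝ) :
    HasDerivAt (fun t => mehlerRate c b l t x y * mehler c b l t x y)
      ((mehlerRateDeriv c b t x y + mehlerRate c b l t x y ^ 2) * mehler c b l t x y) t := by
  refine ((hasDerivAt_mehlerRate hc ht x y).mul
    (hasDerivAt_mehler_time hc ht x y)).congr_deriv ?_
  ring

theorem hasDerivAt_mehlerSlope (x y : ℝ) :
    HasDerivAt (fun x => mehlerSlope c b t x y) (-(c * coth (2 * c * t))) x := by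
  have h : HasDerivAt (fun x => x + b) 1 x := (hasDerivAt_id x).add_const b
  refine (((h.mul_const (coth (2 * c * t))).sub_const
    ((y + b) * csch (2 * c * t))).const_mul c).neg.congr_deriv ?_
  ring

theorem hasDerivAt_mehler_space (x y : ℝ) :
    HasDerivAt (fun x => mehler c b l t x y)
      (mehlerSlope c b t x y * mehler c b l t x y) x := by
  have h : HasDerivAt (fun x => x + b) 1 x := (hasDerivAt_id x).add_const b
  refine ((((((h.pow 2).add_const ((y + b) ^ 2)).mul_const (coth (2 * c * t))).sub
    (((h.mul_const (y + b)).const_mul 2).mul_const (csch (2 * c * t)))).const_mul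
      (-(c / 2))).exp.const_mul
      (√(c * csch (2 * c * t) / (2 * Real.pi)) * Real.exp (-l * t))).congr_deriv ?_
  rw [mehler, mehlerSlope]
  simp only [Pi.sub_apply, Pi.pow_apply, Nat.cast_ofNat]
  ring

theorem hasDerivAt_mehler_space_space (x y : ℝ) :
    HasDerivAt (fun x => mehlerSlope c b t x y * mehler c b l t x y)
      ((mehlerSlope c b t x y ^ 2 - c * coth (2 * c * t)) * mehler c b l t x y) x := by
  refine ((hasDerivAt_mehlerSlope x y).mul (hasDerivAt_mehler_space x y)).congr_deriv ?_
  ring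

/-- `mehler` solves the heat equation. -/
theorem mehler_heat_equation (hc : 0 < c) (ht : 0 < t) (x y : ℝ) :
    (mehlerSlope c b t x y ^ 2 - c * coth (2 * c * t)) * mehler c b l t x y
      - (c ^ 2 * (x + b) ^ 2 + l) * mehler c b l t x y
      = mehlerRate c b l t x y * mehler c b l t x y := by
  have h := coth_sq_sub_one (s := 2 * c * t) (by positivity)
  rw [← sub_mul]
  congr 1
  -- Both sides are quadratic in `x + b`, `y + b` and agree through `coth² - 1 = csch²`. The square
  -- is expanded so that `csch²` appears and can be replaced.
  rw [mehlerSlope, mehlerRate, ← h,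
    show (-(c * ((x + b) * coth (2 * c * t) - (y + b) * csch (2 * c * t)))) ^ 2
      = c ^ 2 * ((x + b) ^ 2 * coth (2 * c * t) ^ 2
        - 2 * ((x + b) * (y + b)) * (coth (2 * c * t) * csch (2 * c * t))
        + (y + b) ^ 2 * csch (2 * c * t) ^ 2) by ring, ← h]
  ring

theorem contDiff_mehler (y : ℝ) : ContDiff ℝ ∞ fun x => mehler c b l t x y := by
  unfold mehler; fun_prop

theorem contDiff_mehlerSlope_mul (y : ℝ) :
    ContDiff ℝ ∞ fun x => mehlerSlope c b t x y * mehler c b l t x y := by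
  unfold mehlerSlope mehler; fun_prop

end

/-! ### Gaussian domination of the Mehler kernel -/

/-- The Gaussian `exp (-κ (x + b)²)`. -/
def gauss (κ b x : ℝ) : ℝ := Real.exp (-κ * (x + b) ^ 2)

theorem memLp_gauss {κ : ℝ} (hκ : 0 < κ) (b : ℝ) : MemLp (gauss κ b) 2 := by
  have hc : Continuous (gauss κ b) := by unfold gauss; fun_prop
  refine (memLp_two_iff_integrable_sq hc.aestronglyMeasurable).2 ?_
  have := (integrable_exp_neg_mul_sq (b := 2 * κ) (by positivity)).comp_add_right b
  refine this.congr (Eventually.of_forall fun x => ?_)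
  simp only [gauss]
  rw [← Real.exp_nat_mul]
  congr 1
  push_cast
  ring

theorem gauss_nonneg (κ b x : ℝ) : 0 ≤ gauss κ b x := (Real.exp_pos _).le

/-- Locally uniformly in time, `mehler` times a polynomial of degree four is dominated by a
Gaussian. -/
theorem exists_mehler_le {c b l t₁ t₂ : ℝ} (hc : 0 < c) (h₁ : 0 < t₁) (h₂ : t₁ ≤ t₂) :
    ∃ κ > 0, ∃ A ≥ 0, ∀ t ∈ Set.Icc t₁ t₂, ∀ x y,
      (1 + (x + b) ^ 2 + (y + b) ^ 2) ^ 2 * mehler c b l t x y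
        ≤ A * (gauss κ b x * gauss κ b y) := by
  have hsub : Set.Icc t₁ t₂ ⊆ Set.Ioi 0 := fun t ht => h₁.trans_le ht.1
  have hne : (Set.Icc t₁ t₂).Nonempty := ⟨t₁, le_refl _, h₂⟩
  have c1 := (continuousOn_csch_two_mul hc).mono hsub
  have c2 := (continuousOn_coth_two_mul hc).mono hsub
  obtain ⟨t₀, ht₀, hmin⟩ := isCompact_Icc.exists_isMinOn hne (c2.sub c1)
  obtain ⟨A, hA⟩ := isCompact_Icc.exists_bound_of_continuousOn
    (f := fun t => √(c * csch (2 * c * t) / (2 * Real.pi)) * Real.exp (-l * t))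
    (((c1.const_mul c).div_const _).sqrt.mul (by fun_prop))
  set δ : ℝ := coth (2 * c * t₀) - csch (2 * c * t₀) with hδ
  have hδ0 : 0 < δ := sub_pos.2 (csch_lt_coth (mul_pos (by positivity) (hsub ht₀)))
  -- The exponent of `mehler` is at most `-(c/2)δr = -2κr`. Half of this decay absorbs the
  -- polynomial, by `(1 + r)² ≤ (1 + 2/κ)² e^{κr}`; the other half is the product of Gaussians.
  set κ : ℝ := c * δ / 4 with hκd
  have hκ : 0 < κ := by positivity
  have hA0 : 0 ≤ A := (norm_nonneg _).trans (hA t₁ ⟨le_refl _, h₂⟩)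
  refine ⟨κ, hκ, (1 + 2 / κ) ^ 2 * A, by positivity, fun t ht x y => ?_⟩
  have hAt := (le_abs_self _).trans (hA t ht)
  have hmt : δ ≤ coth (2 * c * t) - csch (2 * c * t) := hmin ht
  have hs := csch_pos (s := 2 * c * t) (mul_pos (by positivity) (hsub ht))
  set r : ℝ := (x + b) ^ 2 + (y + b) ^ 2 with hr
  have hr0 : 0 ≤ r := by positivity
  have e1 : mehler c b l t x y ≤ A * Real.exp (-(2 * κ) * r) := by
    rw [mehler]
    refine mul_le_mul hAt (Real.exp_le_exp.2 ?_) (Real.exp_pos _).le hA0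
    rw [← hr]
    have q1 : δ * r ≤ r * coth (2 * c * t) - 2 * ((x + b) * (y + b)) * csch (2 * c * t) := by
      have q2 := mul_le_mul_of_nonneg_right hmt hr0
      have q3 : 2 * ((x + b) * (y + b)) ≤ r := by nlinarith [sq_nonneg ((x + b) - (y + b))]
      have q4 := mul_le_mul_of_nonneg_right q3 hs.le
      linarith
    have := mul_le_mul_of_nonneg_left q1 (by positivity : 0 ≤ c / 2)
    rw [hκd]
    linarith
  have e2 : 1 + r ≤ (1 + 2 / κ) * Real.exp (κ * r / 2) := by
    have q1 := Real.add_one_le_exp (κ * r / 2)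
    have q2 : 1 + r ≤ (1 + 2 / κ) * (κ * r / 2 + 1) := by
      have : (1 + 2 / κ) * (κ * r / 2 + 1) = 1 + r + (κ * r / 2 + 2 / κ) := by
        field_simp; ring
      rw [this]
      have : 0 ≤ κ * r / 2 + 2 / κ := by positivity
      linarith
    exact q2.trans (mul_le_mul_of_nonneg_left q1 (by positivity))
  have e3 : (1 + r) ^ 2 ≤ ((1 + 2 / κ) * Real.exp (κ * r / 2)) ^ 2 :=
    pow_le_pow_left₀ (by positivity) e2 2
  rw [add_assoc, ← hr]
  refine (mul_le_mul e3 e1 (mehler_nonneg x y) (by positivity)).trans (le_of_eq ?_)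
  rw [mul_pow, gauss, gauss, ← Real.exp_add, ← Real.exp_nat_mul,
    show (1 + 2 / κ) ^ 2 * Real.exp (((2 : ℕ) : ℝ) * (κ * r / 2)) * (A * Real.exp (-(2 * κ) * r))
      = (1 + 2 / κ) ^ 2 * A * (Real.exp (((2 : ℕ) : ℝ) * (κ * r / 2)) * Real.exp (-(2 * κ) * r))
      by ring, ← Real.exp_add]
  congr 2
  push_cast
  rw [hr]
  ring

/-- `mehlerRate` and `mehlerRateDeriv` both have this shape in `x + b`, `y + b`, so bounds on their
coefficients suffice. -/
theorem abs_quadratic_le {α β γ B : ℝ} (hα : |α| ≤ B) (hβ : |β| ≤ B) (hγ : |γ| ≤ B) (m n : ℝ) :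
    |α + β * (m ^ 2 + n ^ 2) + γ * (m * n)| ≤ 2 * B * (1 + m ^ 2 + n ^ 2) := by
  have hB : 0 ≤ B := (abs_nonneg _).trans hα
  have h1 : |m * n| ≤ m ^ 2 + n ^ 2 := by
    rw [abs_mul]
    nlinarith [sq_nonneg (|m| - |n|), sq_abs m, sq_abs n, sq_nonneg m, sq_nonneg n]
  have h2 : 0 ≤ m ^ 2 + n ^ 2 := by positivity
  calc _ ≤ |α| + |β| * (m ^ 2 + n ^ 2) + |γ| * |m * n| := by
        refine (abs_add_le _ _).trans (add_le_add ((abs_add_le _ _).trans ?_) (abs_mul _ _).le)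
        rw [abs_mul, abs_of_nonneg h2]
    _ ≤ B + B * (m ^ 2 + n ^ 2) + B * (m ^ 2 + n ^ 2) :=
        add_le_add (add_le_add hα (mul_le_mul_of_nonneg_right hβ h2))
          (mul_le_mul hγ h1 (abs_nonneg _) hB)
    _ ≤ _ := by nlinarith

/-- The kernel, its first time derivative and its first two space derivatives are all polynomial
multiples of `mehler`; this one estimate covers them. -/
theorem isDominated_mul_mehler {κ A B c b l t : ℝ} {P : ℝ → ℝ → ℝ} (hB : 0 ≤ B)
    (hA : ∀ x y, (1 + (x + b) ^ 2 + (y + b) ^ 2) ^ 2 * mehler c b l t x y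
      ≤ A * (gauss κ b x * gauss κ b y))
    (hP : Continuous (Function.uncurry P))
    (hPB : ∀ x y, |P x y| ≤ B * (1 + (x + b) ^ 2 + (y + b) ^ 2) ^ 2) :
    IsDominated (gauss κ b) (B * A) fun x y => P x y * mehler c b l t x y := by
  refine ⟨hP.mul continuous_mehler, fun x y => ?_⟩
  rw [abs_mul, abs_of_nonneg (mehler_nonneg x y)]
  calc _ ≤ B * (1 + (x + b) ^ 2 + (y + b) ^ 2) ^ 2 * mehler c b l t x y :=
        mul_le_mul_of_nonneg_right (hPB x y) (mehler_nonneg x y)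
    _ = B * ((1 + (x + b) ^ 2 + (y + b) ^ 2) ^ 2 * mehler c b l t x y) := by ring
    _ ≤ B * (A * (gauss κ b x * gauss κ b y)) := mul_le_mul_of_nonneg_left (hA x y) hB
    _ = _ := by ring

theorem isDominated_mehler {κ A c b l t : ℝ}
    (hA : ∀ x y, (1 + (x + b) ^ 2 + (y + b) ^ 2) ^ 2 * mehler c b l t x y
      ≤ A * (gauss κ b x * gauss κ b y)) :
    IsDominated (gauss κ b) A (mehler c b l t) := by
  have := isDominated_mul_mehler (P := fun _ _ => 1) zero_le_one hA continuous_const fun x y => by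
    rw [abs_one, one_mul]
    exact one_le_pow₀ (by nlinarith [sq_nonneg (x + b), sq_nonneg (y + b)])
  simpa using this

theorem exists_isDominated_mehler {c b l t : ℝ} (hc : 0 < c) (ht : 0 < t) :
    ∃ κ > 0, ∃ A, IsDominated (gauss κ b) A (mehler c b l t) := by
  obtain ⟨κ, hκ, A, -, hA⟩ := exists_mehler_le (b := b) (l := l) hc ht le_rfl
  exact ⟨κ, hκ, A, isDominated_mehler (hA t ⟨le_rfl, le_rfl⟩)⟩

theorem continuous_mehlerRate {c b l t : ℝ} :
    Continuous (Function.uncurry (mehlerRate c b l t)) := by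
  unfold mehlerRate Function.uncurry; fun_prop

theorem continuous_mehlerSlope {c b t : ℝ} :
    Continuous (Function.uncurry (mehlerSlope c b t)) := by
  unfold mehlerSlope Function.uncurry; fun_prop

theorem exists_abs_mehlerRate_le {c b l t₁ t₂ : ℝ} (hc : 0 < c) (h₁ : 0 < t₁) :
    ∃ B ≥ 0, ∀ t ∈ Set.Icc t₁ t₂, ∀ x y,
      |mehlerRate c b l t x y| ≤ B * (1 + (x + b) ^ 2 + (y + b) ^ 2) ∧
      |mehlerRateDeriv c b t x y| ≤ B * (1 + (x + b) ^ 2 + (y + b) ^ 2) := by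
  have hsub : Set.Icc t₁ t₂ ⊆ Set.Ioi 0 := fun t ht => h₁.trans_le ht.1
  have c1 := (continuousOn_csch_two_mul hc).mono hsub
  have c2 := (continuousOn_coth_two_mul hc).mono hsub
  obtain ⟨B₁, hB₁⟩ := isCompact_Icc.exists_bound_of_continuousOn
    (f := fun t => -(c * coth (2 * c * t)) - l) (by fun_prop)
  obtain ⟨B₂, hB₂⟩ := isCompact_Icc.exists_bound_of_continuousOn
    (f := fun t => c ^ 2 * csch (2 * c * t) ^ 2) (by fun_prop)
  obtain ⟨B₃, hB₃⟩ := isCompact_Icc.exists_bound_of_continuousOn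
    (f := fun t => -(2 * c ^ 2 * (csch (2 * c * t) * coth (2 * c * t)))) (by fun_prop)
  obtain ⟨B₄, hB₄⟩ := isCompact_Icc.exists_bound_of_continuousOn
    (f := fun t => 2 * c ^ 2 * csch (2 * c * t) ^ 2) (by fun_prop)
  obtain ⟨B₅, hB₅⟩ := isCompact_Icc.exists_bound_of_continuousOn
    (f := fun t => -(4 * c ^ 3 * (csch (2 * c * t) ^ 2 * coth (2 * c * t)))) (by fun_prop)
  obtain ⟨B₆, hB₆⟩ := isCompact_Icc.exists_bound_of_continuousOn
    (f := fun t => 4 * c ^ 3 * (csch (2 * c * t) * coth (2 * c * t) ^ 2 + csch (2 * c * t) ^ 3))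
    (by fun_prop)
  let S : ℝ := |B₁| + |B₂| + |B₃| + |B₄| + |B₅| + |B₆|
  have n1 := abs_nonneg B₁
  have n2 := abs_nonneg B₂
  have n3 := abs_nonneg B₃
  have n4 := abs_nonneg B₄
  have n5 := abs_nonneg B₅
  have n6 := abs_nonneg B₆
  refine ⟨2 * S, by positivity, fun t ht x y => ⟨?_, ?_⟩⟩
  · refine abs_quadratic_le ((hB₁ t ht).trans ((le_abs_self _).trans ?_))
      ((hB₂ t ht).trans ((le_abs_self _).trans ?_)) ((hB₃ t ht).trans ((le_abs_self _).trans ?_))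
      _ _ <;> simp only [S] <;> linarith
  · refine abs_quadratic_le ((hB₄ t ht).trans ((le_abs_self _).trans ?_))
      ((hB₅ t ht).trans ((le_abs_self _).trans ?_)) ((hB₆ t ht).trans ((le_abs_self _).trans ?_))
      _ _ <;> simp only [S] <;> linarith

theorem isDominated_mehlerRate_mul {κ A B c b l t : ℝ} (hB : 0 ≤ B)
    (hA : ∀ x y, (1 + (x + b) ^ 2 + (y + b) ^ 2) ^ 2 * mehler c b l t x y
      ≤ A * (gauss κ b x * gauss κ b y))
    (hr : ∀ x y, |mehlerRate c b l t x y| ≤ B * (1 + (x + b) ^ 2 + (y + b) ^ 2)) :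
    IsDominated (gauss κ b) (B * A)
      fun x y => mehlerRate c b l t x y * mehler c b l t x y := by
  refine isDominated_mul_mehler hB hA continuous_mehlerRate fun x y => (hr x y).trans ?_
  refine mul_le_mul_of_nonneg_left (le_self_pow₀ ?_ two_ne_zero) hB
  nlinarith [sq_nonneg (x + b), sq_nonneg (y + b)]

/-! ### The Mehler operators satisfy the heat equation -/

theorem hasDerivAt_integralOp_mehler {c b l t : ℝ} (hc : 0 < c) (ht : 0 < t) (f : L2 𝕜) :
    HasDerivAt (fun t => integralOp (mehler c b l t) f)
      (integralOp (fun x y => mehlerRate c b l t x y * mehler c b l t x y) f) t := by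
  have h2 : 0 < t / 2 := half_pos ht
  -- On `[t/2, 2t]`, a compact neighbourhood of `t` in `(0, ∞)`, the constants are uniform in time.
  obtain ⟨κ, hκ, A, hA0, hA⟩ :=
    exists_mehler_le (b := b) (l := l) (t₁ := t / 2) (t₂ := 2 * t) hc h2 (by linarith)
  obtain ⟨B, hB0, hB⟩ :=
    exists_abs_mehlerRate_le (b := b) (l := l) (t₁ := t / 2) (t₂ := 2 * t) hc h2
  refine hasDerivAt_integralOp (a := t / 2) (b := 2 * t) (g := gauss κ b)
    (K' := fun t x y => mehlerRate c b l t x y * mehler c b l t x y)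
    (K'' := fun t x y => (mehlerRateDeriv c b t x y + mehlerRate c b l t x y ^ 2)
      * mehler c b l t x y) (C := A) (C₁ := B * A) (C' := (B + B ^ 2) * A)
    ⟨by linarith, by linarith⟩ (memLp_gauss hκ b) (gauss_nonneg κ b) ?_ ?_ ?_ ?_ ?_ f
  · exact fun s hs => isDominated_mehler (hA s ⟨hs.1.le, hs.2.le⟩)
  · exact fun s hs => isDominated_mehlerRate_mul hB0 (hA s ⟨hs.1.le, hs.2.le⟩)
      fun x y => (hB s ⟨hs.1.le, hs.2.le⟩ x y).1
  · intro s hs x y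
    obtain ⟨r1, r2⟩ := hB s ⟨hs.1.le, hs.2.le⟩ x y
    have hAs := hA s ⟨hs.1.le, hs.2.le⟩ x y
    rw [abs_mul, abs_of_nonneg (mehler_nonneg x y)]
    set R : ℝ := 1 + (x + b) ^ 2 + (y + b) ^ 2 with hR
    have hR1 : 1 ≤ R := by nlinarith [sq_nonneg (x + b), sq_nonneg (y + b)]
    -- The square of the quadratic rate is what requires a weight of degree four in
    -- `exists_mehler_le`.
    have e1 : |mehlerRateDeriv c b s x y + mehlerRate c b l s x y ^ 2| ≤ (B + B ^ 2) * R ^ 2 := by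
      refine (abs_add_le _ _).trans ?_
      rw [add_mul, abs_pow, ← mul_pow]
      refine add_le_add (r2.trans (mul_le_mul_of_nonneg_left ?_ hB0))
        (pow_le_pow_left₀ (abs_nonneg _) r1 2)
      exact le_self_pow₀ hR1 two_ne_zero
    calc _ ≤ (B + B ^ 2) * R ^ 2 * mehler c b l s x y :=
          mul_le_mul_of_nonneg_right e1 (mehler_nonneg x y)
      _ = (B + B ^ 2) * (R ^ 2 * mehler c b l s x y) := by ring
      _ ≤ (B + B ^ 2) * (A * (gauss κ b x * gauss κ b y)) :=
          mul_le_mul_of_nonneg_left hAs (by positivity)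
      _ = _ := by ring
  · exact fun s hs x y => hasDerivAt_mehler_time hc (h2.trans hs.1) x y
  · exact fun s hs x y => hasDerivAt_mehler_time_time hc (h2.trans hs.1) x y

/-- By `mehler_heat_equation`, `∂ₓ²K - VK` is the time derivative of the kernel, so `-H` acts on
these functions as differentiation in time. -/
theorem operatorGraph_integralOp_mehler {c b l t : ℝ} (hc : 0 < c) (ht : 0 < t) (f : L2 𝕜) :
    OperatorGraph (fun x => c ^ 2 * (x + b) ^ 2 + l) (integralOp (mehler c b l t) f)
      (-integralOp (fun x y => mehlerRate c b l t x y * mehler c b l t x y) f) := by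
  obtain ⟨κ, hκ, A, hA0, hA'⟩ := exists_mehler_le (b := b) (l := l) hc ht le_rfl
  have hA := hA' t ⟨le_rfl, le_rfl⟩
  obtain ⟨B, hB0, hB⟩ :=
    exists_abs_mehlerRate_le (b := b) (l := l) (t₁ := t) (t₂ := t) hc ht
  let S : ℝ := c * (|coth (2 * c * t)| + |csch (2 * c * t)|)
  have hS0 : 0 ≤ S := by positivity
  have hslope : ∀ x y, |mehlerSlope c b t x y| ≤ S * (1 + (x + b) ^ 2 + (y + b) ^ 2) := by
    intro x y
    rw [mehlerSlope, abs_neg, abs_mul, abs_of_pos hc]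
    simp only [S]
    rw [mul_assoc c (_ + _)]
    refine mul_le_mul_of_nonneg_left ((abs_sub _ _).trans ?_) hc.le
    rw [abs_mul, abs_mul, add_mul]
    have hm : |x + b| ≤ 1 + (x + b) ^ 2 + (y + b) ^ 2 := by
      nlinarith [sq_nonneg (|x + b| - 1), sq_abs (x + b), sq_nonneg (x + b), sq_nonneg (y + b)]
    have hn : |y + b| ≤ 1 + (x + b) ^ 2 + (y + b) ^ 2 := by
      nlinarith [sq_nonneg (|y + b| - 1), sq_abs (y + b), sq_nonneg (x + b), sq_nonneg (y + b)]
    refine add_le_add ?_ ?_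
    · rw [mul_comm]; exact mul_le_mul_of_nonneg_left hm (abs_nonneg _)
    · rw [mul_comm]; exact mul_le_mul_of_nonneg_left hn (abs_nonneg _)
  have hR1 : ∀ x y : ℝ, 1 ≤ 1 + (x + b) ^ 2 + (y + b) ^ 2 := fun x y => by
    nlinarith [sq_nonneg (x + b), sq_nonneg (y + b)]
  refine IsDominated.operatorGraph (g := gauss κ b) (by fun_prop) (memLp_gauss hκ b)
    (K₁ := fun x y => mehlerSlope c b t x y * mehler c b l t x y)
    (K₂ := fun x y => (mehlerSlope c b t x y ^ 2 - c * coth (2 * c * t)) * mehler c b l t x y)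
    (isDominated_mehler hA) (isDominated_mul_mehler hS0 hA continuous_mehlerSlope ?_)
    (isDominated_mul_mehler (B := S ^ 2 + |c * coth (2 * c * t)|) (by positivity) hA ?_ ?_)
    (isDominated_mehlerRate_mul hB0 hA fun x y => (hB t ⟨le_rfl, le_rfl⟩ x y).1)
    contDiff_mehler contDiff_mehlerSlope_mul (fun y x => hasDerivAt_mehler_space x y)
    (fun y x => hasDerivAt_mehler_space_space x y) (mehler_heat_equation hc ht) f
  · exact fun x y => (hslope x y).trans
      (mul_le_mul_of_nonneg_left (le_self_pow₀ (hR1 x y) two_ne_zero) hS0)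
  · exact (continuous_mehlerSlope.pow 2).sub continuous_const
  · intro x y
    refine (abs_sub _ _).trans ?_
    rw [add_mul, abs_pow, ← mul_pow]
    refine add_le_add (pow_le_pow_left₀ (abs_nonneg _) (hslope x y) 2) ?_
    exact le_mul_of_one_le_right (abs_nonneg _) (one_le_pow₀ (hR1 x y))

/-! ### Norm bound and initial value -/

/-- The Schur test for a symmetric dominated kernel. -/
theorem IsDominated.norm_integralOp_le_of_symm {g : ℝ → ℝ} {C M : ℝ} {K : ℝ → ℝ → ℝ}
    (hK : IsDominated g C K) (hg : MemLp g 2) (hg1 : Integrable g) (hgb : ∀ x, g x ≤ 1)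
    (hg0 : ∀ x, 0 ≤ g x) (hM : 0 < M) (h0 : ∀ x y, 0 ≤ K x y) (hsymm : ∀ x y, K x y = K y x)
    (hKM : ∀ x, ∫ y, K x y ≤ M) (f : L2 𝕜) : ‖integralOp K f‖ ≤ M * ‖f‖ := by
  have hf2 := integrable_norm_sq f
  have hKc : ∀ x, Continuous fun y => K x y := fun x =>
    hK.continuous.comp (continuous_const.prodMk continuous_id)
  have hKi : ∀ x, Integrable fun y => K x y := fun x => by
    refine ((hg1.const_mul (C * g x))).mono' (hKc x).aestronglyMeasurable
      (Eventually.of_forall fun y => ?_)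
    rw [Real.norm_eq_abs, mul_assoc]
    exact hK.bound x y
  have hprod : Integrable (fun z : ℝ × ℝ => K z.1 z.2 * ‖f z.2‖ ^ 2)
      ((volume : Measure ℝ).prod volume) := by
    refine ((hg1.mul_prod hf2).const_mul |C|).mono'
      (hK.continuous.aestronglyMeasurable.mul ((Lp.aestronglyMeasurable f).comp_snd.norm.pow 2))
      (Eventually.of_forall fun z => ?_)
    rw [norm_mul, Real.norm_eq_abs, norm_pow, norm_norm, ← mul_assoc]
    refine mul_le_mul_of_nonneg_right ((hK.bound _ _).trans ?_) (sq_nonneg _)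
    refine mul_le_mul (le_abs_self C) (mul_le_of_le_one_right (hg0 _) (hgb _))
      (mul_nonneg (hg0 _) (hg0 _)) (abs_nonneg _)
  have hpoint : ∀ x, Integrable (fun y => K x y * ‖f y‖ ^ 2) →
      ‖∫ y, K x y • f y‖ ^ 2 ≤ M * ∫ y, K x y * ‖f y‖ ^ 2 := by
    intro x hx2
    have hx1 : Integrable fun y => K x y * ‖f y‖ :=
      (hK.memLp_left hg x).integrable_mul (memLp_coe f).norm
    have e1 : ‖∫ y, K x y • f y‖ ≤ ∫ y, K x y * ‖f y‖ := by
      refine (norm_integral_le_integral_norm _).trans (le_of_eq ?_)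
      simp_rw [norm_smul, Real.norm_of_nonneg (h0 x _)]
    set I : ℝ := ∫ y, K x y * ‖f y‖ with hI
    have hI0 : 0 ≤ I := (norm_nonneg _).trans e1
    -- Weighted Cauchy–Schwarz: expanding `0 ≤ ∫ K(‖f‖ - a)²` and using `∫ K ≤ M` with `a = I/M`
    -- yields `I² ≤ M ∫ K‖f‖²`.
    set a : ℝ := I / M with ha
    have e2 : 0 ≤ ∫ y, K x y * (‖f y‖ - a) ^ 2 :=
      integral_nonneg fun y => mul_nonneg (h0 x y) (sq_nonneg _)
    have e3 : ∫ y, K x y * (‖f y‖ - a) ^ 2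
        = (∫ y, K x y * ‖f y‖ ^ 2) - 2 * a * I + a ^ 2 * ∫ y, K x y := by
      rw [hI, ← integral_const_mul, ← integral_const_mul,
        ← integral_sub hx2 (hx1.const_mul (2 * a)),
        ← integral_add (f := fun y => K x y * ‖f y‖ ^ 2 - 2 * a * (K x y * ‖f y‖))
          (hx2.sub (hx1.const_mul (2 * a))) ((hKi x).const_mul (a ^ 2))]
      refine integral_congr_ae (Eventually.of_forall fun y => ?_)
      simp only
      ring
    have e4 : a ^ 2 * ∫ y, K x y ≤ a ^ 2 * M := mul_le_mul_of_nonneg_left (hKM x) (sq_nonneg _)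
    have e5 : I = a * M := by rw [ha]; field_simp
    have e6 : a ^ 2 * M ≤ ∫ y, K x y * ‖f y‖ ^ 2 := by
      rw [e3, e5] at e2
      nlinarith
    calc _ ≤ I ^ 2 := pow_le_pow_left₀ (norm_nonneg _) e1 2
      _ = M * (a ^ 2 * M) := by rw [e5]; ring
      _ ≤ _ := mul_le_mul_of_nonneg_left e6 hM.le
  have hsq : ‖integralOp K f‖ ^ 2 ≤ (M * ‖f‖) ^ 2 := by
    rw [norm_sq_eq_integral]
    calc _ ≤ ∫ x, M * ∫ y, K x y * ‖f y‖ ^ 2 := by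
          refine integral_mono_ae (integrable_norm_sq _) (hprod.integral_prod_left.const_mul M) ?_
          filter_upwards [hK.coeFn hg f, hprod.prod_right_ae] with x h1 h2
          rw [h1]
          exact hpoint x h2
      _ = M * ∫ y, ∫ x, K x y * ‖f y‖ ^ 2 := by
          rw [integral_const_mul, integral_integral_swap hprod]
      _ ≤ M * ∫ y, M * ‖f y‖ ^ 2 := by
          refine mul_le_mul_of_nonneg_left ?_ hM.le
          refine integral_mono hprod.integral_prod_right (hf2.const_mul M) fun y => ?_
          simp only
          rw [integral_mul_const]
          refine mul_le_mul_of_nonneg_right ?_ (sq_nonneg _)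
          simp_rw [fun x => hsymm x y]
          exact hKM y
      _ = _ := by rw [integral_const_mul, ← norm_sq_eq_integral]; ring
  exact le_of_sq_le_sq hsq (by positivity)

theorem integrable_gauss {κ : ℝ} (hκ : 0 < κ) (b : ℝ) : Integrable (gauss κ b) :=
  (integrable_exp_neg_mul_sq hκ).comp_add_right b

theorem gauss_le_one {κ : ℝ} (hκ : 0 < κ) (b x : ℝ) : gauss κ b x ≤ 1 :=
  Real.exp_le_one_iff.2 (by nlinarith [sq_nonneg (x + b), mul_nonneg hκ.le (sq_nonneg (x + b))])

theorem mehler_symm (c b l t x y : ℝ) : mehler c b l t x y = mehler c b l t y x := by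
  rw [mehler, mehler, add_comm ((x + b) ^ 2), mul_comm (x + b)]

/-- Since `coth > csch`, the exponent is at most `-(c csch(2ct)/2)(y - x)²`, and the integral of
this Gaussian cancels the square-root prefactor exactly. -/
theorem integral_mehler_le {c b l t : ℝ} (hc : 0 < c) (ht : 0 < t) (x : ℝ) :
    ∫ y, mehler c b l t x y ≤ Real.exp (-l * t) := by
  obtain ⟨κ, hκ, A, hA⟩ := exists_isDominated_mehler (b := b) (l := l) hc ht
  have hs := csch_pos (s := 2 * c * t) (by positivity)
  have hcs := csch_lt_coth (s := 2 * c * t) (by positivity)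
  set s := csch (2 * c * t) with hsd
  have hq : 0 < c * s / 2 := by positivity
  have hi := (integrable_exp_neg_mul_sq hq).comp_sub_right x
  have hle : ∀ y, mehler c b l t x y ≤ √(c * s / (2 * Real.pi)) * Real.exp (-l * t)
      * Real.exp (-(c * s / 2) * (y - x) ^ 2) := by
    intro y
    rw [mehler, ← hsd]
    refine mul_le_mul_of_nonneg_left (Real.exp_le_exp.2 ?_) (by positivity)
    have q := mul_nonneg (mul_nonneg hc.le (sub_nonneg.2 hcs.le))
      (add_nonneg (sq_nonneg (x + b)) (sq_nonneg (y + b)))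
    nlinarith
  have hmi : Integrable fun y => mehler c b l t x y := by
    refine (hi.const_mul (√(c * s / (2 * Real.pi)) * Real.exp (-l * t))).mono'
      (Continuous.aestronglyMeasurable
        (continuous_mehler.comp (continuous_const.prodMk continuous_id)))
      (Eventually.of_forall fun y => ?_)
    rw [Real.norm_of_nonneg (mehler_nonneg x y)]
    exact hle y
  refine (integral_mono hmi (hi.const_mul _) hle).trans (le_of_eq ?_)
  rw [integral_const_mul,
    integral_sub_right_eq_self (fun y => Real.exp (-(c * s / 2) * y ^ 2)) x, integral_gaussian,
    mul_right_comm, ← Real.sqrt_mul (by positivity),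
    show c * s / (2 * Real.pi) * (Real.pi / (c * s / 2)) = 1 by field_simp, Real.sqrt_one, one_mul]

theorem norm_integralOp_mehler_le {c b l t : ℝ} (hc : 0 < c) (ht : 0 < t) (f : L2 𝕜) :
    ‖integralOp (mehler c b l t) f‖ ≤ Real.exp (-l * t) * ‖f‖ := by
  obtain ⟨κ, hκ, A, hA⟩ := exists_isDominated_mehler (b := b) (l := l) hc ht
  exact hA.norm_integralOp_le_of_symm (memLp_gauss hκ b) (integrable_gauss hκ b)
    (gauss_le_one hκ b) (gauss_nonneg κ b) (Real.exp_pos _) (fun x y => mehler_nonneg x y)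
    (mehler_symm c b l t) (integral_mehler_le hc ht) f

theorem integralOp_mehler_sub {c b l t : ℝ} (hc : 0 < c) (ht : 0 < t) (f g : L2 𝕜) :
    integralOp (mehler c b l t) (f - g)
      = integralOp (mehler c b l t) f - integralOp (mehler c b l t) g := by
  obtain ⟨κ, hκ, A, hA⟩ := exists_isDominated_mehler (b := b) (l := l) hc ht
  have hg := memLp_gauss hκ b
  refine Lp.ext ?_
  filter_upwards [hA.coeFn hg (f - g), hA.coeFn hg f, hA.coeFn hg g,
    Lp.coeFn_sub (integralOp (mehler c b l t) f) (integralOp (mehler c b l t) g)] with x h1 h2 h3 h4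
  rw [h4, Pi.sub_apply, h1, h2, h3, ← integral_sub (hA.integrable_smul hg f x)
    (hA.integrable_smul hg g x)]
  refine integral_congr_ae ?_
  filter_upwards [Lp.coeFn_sub f g] with y hy
  rw [hy, Pi.sub_apply, smul_sub]

/-- The length scale `√(sinh (2 c t) / c)` of the heat kernel at time `t`. -/
def mehlerScale (c t : ℝ) : ℝ := √(Real.sinh (2 * c * t) / c)

theorem mehlerScale_pos {c t : ℝ} (hc : 0 < c) (ht : 0 < t) : 0 < mehlerScale c t :=
  Real.sqrt_pos.2 (div_pos (Real.sinh_pos_iff.2 (by positivity)) hc)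

/-- In units of the length scale the kernel is the standard Gaussian density times factors that tend
to `1` as `t → 0⁺`: the last exponent carries `coth(2ct) - csch(2ct) = tanh(ct)`. -/
theorem mehlerScale_mul_mehler {c b l t : ℝ} (hc : 0 < c) (ht : 0 < t) (x w : ℝ) :
    mehlerScale c t * mehler c b l t x (x + mehlerScale c t * w)
      = (√(2 * Real.pi))⁻¹ * Real.exp (-l * t) * Real.exp (-(1 / 2) * w ^ 2)
        * Real.exp (-(c / 2) * ((x + b) ^ 2 + (x + mehlerScale c t * w + b) ^ 2)
          * (Real.sinh (c * t) / Real.cosh (c * t))) := by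
  have hsinh : 0 < Real.sinh (2 * c * t) := Real.sinh_pos_iff.2 (by positivity)
  have hsq : mehlerScale c t ^ 2 = Real.sinh (2 * c * t) / c :=
    Real.sq_sqrt (div_pos hsinh hc).le
  have h1 : mehlerScale c t * √(c * csch (2 * c * t) / (2 * Real.pi)) = (√(2 * Real.pi))⁻¹ := by
    rw [mehlerScale, ← Real.sqrt_mul (div_pos hsinh hc).le, ← Real.sqrt_inv]
    congr 1
    rw [csch]
    field_simp
  have h2 : coth (2 * c * t) - csch (2 * c * t) = Real.sinh (c * t) / Real.cosh (c * t) := by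
    have hs : Real.sinh (c * t) ≠ 0 := (Real.sinh_pos_iff.2 (by positivity)).ne'
    have hch := (Real.cosh_pos (c * t)).ne'
    rw [coth, csch, ← sub_div, mul_assoc, Real.sinh_two_mul, Real.cosh_two_mul, Real.cosh_sq]
    field_simp
    ring
  have h3 : c * csch (2 * c * t) * mehlerScale c t ^ 2 = 1 := by
    rw [hsq, csch]
    field_simp
  rw [mehler, ← mul_assoc, ← mul_assoc, h1, mul_assoc _ (Real.exp (-(1 / 2) * w ^ 2)),
    ← Real.exp_add, ← h2]
  congr 2
  linear_combination (-(1 / 2) * w ^ 2) * h3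

theorem integral_mehler_smul {c b l t : ℝ} (hc : 0 < c) (ht : 0 < t) (φ : ℝ → 𝕜) (x : ℝ) :
    ∫ y, mehler c b l t x y • φ y
      = ∫ w, ((√(2 * Real.pi))⁻¹ * Real.exp (-l * t) * Real.exp (-(1 / 2) * w ^ 2)
        * Real.exp (-(c / 2) * ((x + b) ^ 2 + (x + mehlerScale c t * w + b) ^ 2)
          * (Real.sinh (c * t) / Real.cosh (c * t)))) • φ (x + mehlerScale c t * w) := by
  have hε := mehlerScale_pos hc ht
  simp_rw [← mehlerScale_mul_mehler hc ht, mul_smul]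
  rw [integral_smul, Measure.integral_comp_mul_left
    (fun z => mehler c b l t x (x + z) • φ (x + z)),
    integral_add_left_eq_self (fun z => mehler c b l t x z • φ z) x, smul_smul,
    abs_of_pos (inv_pos.2 hε), mul_inv_cancel₀ hε.ne', one_smul]

theorem integral_mehler_smul_tendsto {c b l : ℝ} (hc : 0 < c) {φ : ℝ → 𝕜} (hφ : Continuous φ)
    {B : ℝ} (hB : ∀ x, ‖φ x‖ ≤ B) (x : ℝ) :
    Tendsto (fun t => ∫ y, mehler c b l t x y • φ y) (𝓝[>] 0) (𝓝 (φ x)) := by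
  have hB0 : 0 ≤ B := (norm_nonneg _).trans (hB 0)
  have hlim : ∫ w : ℝ, ((√(2 * Real.pi))⁻¹ * Real.exp (-(1 / 2) * w ^ 2)) • φ x = φ x := by
    rw [integral_smul_const, integral_const_mul, integral_gaussian,
      show Real.pi / (1 / 2) = 2 * Real.pi by ring, inv_mul_cancel₀ (by positivity), one_smul]
  have key : Tendsto (fun t => ∫ w, ((√(2 * Real.pi))⁻¹ * Real.exp (-l * t)
      * Real.exp (-(1 / 2) * w ^ 2)
        * Real.exp (-(c / 2) * ((x + b) ^ 2 + (x + mehlerScale c t * w + b) ^ 2)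
          * (Real.sinh (c * t) / Real.cosh (c * t)))) • φ (x + mehlerScale c t * w))
      (𝓝[>] 0) (𝓝 (∫ w : ℝ, ((√(2 * Real.pi))⁻¹ * Real.exp (-(1 / 2) * w ^ 2)) • φ x)) := by
    refine tendsto_integral_filter_of_dominated_convergence
      (fun w => (√(2 * Real.pi))⁻¹ * Real.exp |l| * B * Real.exp (-(1 / 2) * w ^ 2)) ?_ ?_
      ((integrable_exp_neg_mul_sq (by norm_num)).const_mul _) ?_
    · refine Eventually.of_forall fun t => Continuous.aestronglyMeasurable ?_
      fun_prop
    · filter_upwards [Ioo_mem_nhdsGT one_pos] with t ht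
      refine Eventually.of_forall fun w => ?_
      rw [norm_smul, Real.norm_of_nonneg (by positivity)]
      have e1 : Real.exp (-l * t) ≤ Real.exp |l| := by
        refine Real.exp_le_exp.2 ((le_abs_self _).trans ?_)
        rw [abs_mul, abs_neg, abs_of_pos ht.1]
        exact mul_le_of_le_one_right (abs_nonneg _) ht.2.le
      have e2 : Real.exp (-(c / 2) * ((x + b) ^ 2 + (x + mehlerScale c t * w + b) ^ 2)
          * (Real.sinh (c * t) / Real.cosh (c * t))) ≤ 1 := by
        refine Real.exp_le_one_iff.2 ?_
        rw [neg_mul, neg_mul, neg_nonpos]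
        have := (Real.sinh_pos_iff.2 (mul_pos hc ht.1)).le
        have := (Real.cosh_pos (c * t)).le
        positivity
      calc _ ≤ (√(2 * Real.pi))⁻¹ * Real.exp |l| * Real.exp (-(1 / 2) * w ^ 2) * 1 * B := by
            gcongr
            exact hB _
        _ = _ := by ring
    · refine Eventually.of_forall fun w => ?_
      -- Although the kernel is singular at `t = 0`, the rescaled integrand is continuous there:
      -- `mehlerScale` vanishes, leaving the Gaussian density times `φ x`.
      have hcont : Continuous fun t => ((√(2 * Real.pi))⁻¹ * Real.exp (-l * t)
          * Real.exp (-(1 / 2) * w ^ 2)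
          * Real.exp (-(c / 2) * ((x + b) ^ 2 + (x + mehlerScale c t * w + b) ^ 2)
          * (Real.sinh (c * t) / Real.cosh (c * t)))) • φ (x + mehlerScale c t * w) := by
        unfold mehlerScale
        have : ∀ t, Real.cosh (c * t) ≠ 0 := fun t => (Real.cosh_pos _).ne'
        fun_prop (disch := assumption)
      have := (hcont.tendsto 0).mono_left (nhdsWithin_le_nhds (s := Set.Ioi 0))
      simpa [mehlerScale] using this
  rw [hlim] at key
  refine key.congr' ?_
  filter_upwards [self_mem_nhdsWithin] with t ht
  exact (integral_mehler_smul hc ht φ x).symm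

theorem exp_neg_mul_tendsto_one (l : ℝ) :
    Tendsto (fun t : ℝ => Real.exp (-l * t)) (𝓝[>] 0) (𝓝 1) := by
  have h : Continuous fun t : ℝ => Real.exp (-l * t) := by fun_prop
  simpa using (h.tendsto 0).mono_left (nhdsWithin_le_nhds (s := Set.Ioi 0))

theorem re_inner_integralOp_mehler_tendsto {c b l : ℝ} (hc : 0 < c) {φ : ℝ → 𝕜}
    (hφ : Continuous φ) (hs : HasCompactSupport φ) (hm : MemLp φ 2 (volume : Measure ℝ)) :
    Tendsto (fun t => RCLike.re (inner 𝕜 (hm.toLp φ) (integralOp (mehler c b l t) (hm.toLp φ))))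
      (𝓝[>] 0) (𝓝 (‖hm.toLp φ‖ ^ 2)) := by
  obtain ⟨B, hB⟩ := hφ.bounded_above_of_compact_support hs
  have hB0 : 0 ≤ B := (norm_nonneg _).trans (hB 0)
  have hi : Integrable fun x => ‖φ x‖ := (hφ.integrable_of_hasCompactSupport hs).norm
  have hmeas : ∀ t, AEStronglyMeasurable (fun x => ∫ y, mehler c b l t x y • φ y) volume := by
    intro t
    have h : AEStronglyMeasurable (fun z : ℝ × ℝ => mehler c b l t z.1 z.2 • φ z.2)
        ((volume : Measure ℝ).prod volume) :=
      (continuous_mehler.smul (hφ.comp continuous_snd)).aestronglyMeasurable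
    exact h.integral_prod_right'
  have key : Tendsto (fun t => ∫ x, inner 𝕜 (φ x) (∫ y, mehler c b l t x y • φ y)) (𝓝[>] 0)
      (𝓝 (∫ x, inner 𝕜 (φ x) (φ x))) := by
    -- For small `t` the row integrals are at most `e^{-lt} < 2`, which gives the majorant `2B‖φ‖`.
    refine tendsto_integral_filter_of_dominated_convergence
      (fun x => 2 * B * ‖φ x‖) ?_ ?_ (hi.const_mul _) ?_
    · exact Eventually.of_forall fun t => hφ.aestronglyMeasurable.inner (hmeas t)
    · filter_upwards [self_mem_nhdsWithin,
        (exp_neg_mul_tendsto_one l).eventually (gt_mem_nhds one_lt_two)] with t ht ht2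
      refine Eventually.of_forall fun x => (norm_inner_le_norm _ _).trans ?_
      rw [mul_comm]
      refine mul_le_mul_of_nonneg_right ?_ (norm_nonneg _)
      obtain ⟨κ, hκ, A, hA⟩ := exists_isDominated_mehler (b := b) (l := l) hc ht
      have hKi : Integrable fun y => mehler c b l t x y := by
        refine (((integrable_gauss hκ b).const_mul (A * gauss κ b x))).mono'
          (Continuous.aestronglyMeasurable
            (continuous_mehler.comp (continuous_const.prodMk continuous_id)))
          (Eventually.of_forall fun y => ?_)
        rw [Real.norm_eq_abs, mul_assoc]
        exact hA.bound x y
      calc _ ≤ ∫ y, mehler c b l t x y * B := by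
            refine norm_integral_le_of_norm_le (hKi.mul_const B) (Eventually.of_forall fun y => ?_)
            rw [norm_smul, Real.norm_of_nonneg (mehler_nonneg x y)]
            exact mul_le_mul_of_nonneg_left (hB y) (mehler_nonneg x y)
        _ ≤ 2 * B := by
            rw [integral_mul_const]
            exact mul_le_mul_of_nonneg_right ((integral_mehler_le hc ht x).trans ht2.le) hB0
    · refine Eventually.of_forall fun x => ?_
      exact tendsto_const_nhds.inner (integral_mehler_smul_tendsto hc hφ hB x)
  have hnorm : ‖hm.toLp φ‖ ^ 2 = RCLike.re (∫ x, inner 𝕜 (φ x) (φ x)) := by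
    rw [← inner_self_eq_norm_sq (𝕜 := 𝕜), L2.inner_def]
    congr 1
    refine integral_congr_ae ?_
    filter_upwards [hm.coeFn_toLp] with x hx
    rw [hx]
  rw [hnorm]
  refine ((RCLike.continuous_re.tendsto _).comp key).congr' ?_
  filter_upwards [self_mem_nhdsWithin] with t ht
  obtain ⟨κ, hκ, A, hA⟩ := exists_isDominated_mehler (b := b) (l := l) hc ht
  rw [Function.comp_apply, L2.inner_def]
  congr 1
  refine integral_congr_ae ?_
  filter_upwards [hm.coeFn_toLp, hA.coeFn (memLp_gauss hκ b) (hm.toLp φ)] with x h1 h2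
  rw [h1, h2]
  congr 1
  refine integral_congr_ae ?_
  filter_upwards [hm.coeFn_toLp] with y hy
  rw [hy]

/-- In `‖TF - F‖² = ‖TF‖² - 2 Re⟨F, TF⟩ + ‖F‖²` the first term is at most `e^{-2lt}‖F‖²` and the
pairing tends to `‖F‖²`. -/
theorem integralOp_mehler_tendsto_of_hasCompactSupport {c b l : ℝ} (hc : 0 < c) {φ : ℝ → 𝕜}
    (hφ : Continuous φ) (hs : HasCompactSupport φ) (hm : MemLp φ 2 (volume : Measure ℝ)) :
    Tendsto (fun t => integralOp (mehler c b l t) (hm.toLp φ)) (𝓝[>] 0) (𝓝 (hm.toLp φ)) := by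
  rw [tendsto_iff_norm_sub_tendsto_zero]
  set F : L2 𝕜 := hm.toLp φ
  have h1 : Tendsto (fun t => (Real.exp (-l * t) * ‖F‖) ^ 2
      - 2 * RCLike.re (inner 𝕜 F (integralOp (mehler c b l t) F)) + ‖F‖ ^ 2) (𝓝[>] 0) (𝓝 0) := by
    have := ((((exp_neg_mul_tendsto_one l).mul_const ‖F‖).pow 2).sub
      ((re_inner_integralOp_mehler_tendsto (b := b) (l := l) hc hφ hs hm).const_mul 2)).add_const
        (‖F‖ ^ 2)
    convert this using 2
    ring
  have h2 : Tendsto (fun t => ‖integralOp (mehler c b l t) F - F‖ ^ 2) (𝓝[>] 0) (𝓝 0) := by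
    refine squeeze_zero' (Eventually.of_forall fun t => sq_nonneg _) ?_ h1
    filter_upwards [self_mem_nhdsWithin] with t ht
    rw [norm_sub_sq (𝕜 := 𝕜), inner_re_symm]
    have := pow_le_pow_left₀ (norm_nonneg _)
      (norm_integralOp_mehler_le (b := b) (l := l) hc ht F) 2
    linarith
  have h3 := h2.sqrt
  simpa using h3

theorem integralOp_mehler_tendsto {c b l : ℝ} (hc : 0 < c) (f : L2 𝕜) :
    Tendsto (fun t => integralOp (mehler c b l t) f) (𝓝[>] 0) (𝓝 f) := by
  rw [Metric.tendsto_nhds]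
  intro ε hε
  -- For small `t` the operator norm is at most `2`, so the three errors are `2 · ε/4`, less than
  -- `ε/4`, and `ε/4`.
  obtain ⟨φ, hs, hle, hφ, hm⟩ := (memLp_coe f).exists_hasCompactSupport_eLpNorm_sub_le
    (by simp) (ε := ENNReal.ofReal (ε / 4)) (by simpa using by positivity)
  have hd : ‖f - hm.toLp φ‖ ≤ ε / 4 := by
    have h1 : f - hm.toLp φ = ((memLp_coe f).sub hm).toLp _ := by
      rw [MemLp.toLp_sub (memLp_coe f) hm, Lp.toLp_coeFn]
    rw [h1, Lp.norm_toLp]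
    exact ENNReal.toReal_le_of_le_ofReal (by positivity) hle
  filter_upwards [self_mem_nhdsWithin,
    (exp_neg_mul_tendsto_one l).eventually (gt_mem_nhds one_lt_two),
    Metric.tendsto_nhds.1 (integralOp_mehler_tendsto_of_hasCompactSupport (b := b) (l := l)
      hc hφ hs hm) (ε / 4) (by positivity)] with t ht ht2 ht3
  rw [dist_eq_norm] at ht3 ⊢
  have h1 : ‖integralOp (mehler c b l t) (f - hm.toLp φ)‖ ≤ 2 * (ε / 4) :=
    (norm_integralOp_mehler_le hc ht _).trans
      (mul_le_mul ht2.le hd (norm_nonneg _) zero_le_two)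
  have h2 : integralOp (mehler c b l t) f - f = integralOp (mehler c b l t) (f - hm.toLp φ)
      + (integralOp (mehler c b l t) (hm.toLp φ) - hm.toLp φ) - (f - hm.toLp φ) := by
    rw [integralOp_mehler_sub hc ht]
    abel
  rw [h2]
  have h3 := norm_sub_le (integralOp (mehler c b l t) (f - hm.toLp φ)
      + (integralOp (mehler c b l t) (hm.toLp φ) - hm.toLp φ)) (f - hm.toLp φ)
  have h4 := norm_add_le (integralOp (mehler c b l t) (f - hm.toLp φ))
    (integralOp (mehler c b l t) (hm.toLp φ) - hm.toLp φ)
  linarith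

/-! ### The Mehler kernel is a heat kernel -/

theorem isHeatSolution_integralOp_mehler {c b l : ℝ} (hc : 0 < c) (f : L2 𝕜) :
    IsHeatSolution (fun x => c ^ 2 * (x + b) ^ 2 + l) f
      (fun t => integralOp (mehler c b l t) f) :=
  ⟨fun _ ht => ⟨_, operatorGraph_integralOp_mehler hc ht f, by
    rw [neg_neg]; exact hasDerivAt_integralOp_mehler hc ht f⟩, integralOp_mehler_tendsto hc f⟩

theorem isHeatKernel_mehler {c b l : ℝ} (hc : 0 < c) :
    IsHeatKernel 𝕜 (fun x => c ^ 2 * (x + b) ^ 2 + l) (fun x y t => mehler c b l t x y) where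
  measurable _ _ := continuous_mehler.aestronglyMeasurable
  exists_solution f := ⟨_, isHeatSolution_integralOp_mehler hc f⟩
  representation f u hu t ht := by
    have hV : Continuous fun x : ℝ => c ^ 2 * (x + b) ^ 2 + l := by fun_prop
    have heq : u t = integralOp (mehler c b l t) f :=
      hu.unique hV (l := l) (fun x => le_add_of_nonneg_left (by positivity))
        (isHeatSolution_integralOp_mehler hc f) ht
    obtain ⟨κ, hκ, A, hA⟩ := exists_isDominated_mehler (b := b) (l := l) hc ht
    filter_upwards [hA.coeFn (memLp_gauss hκ b) f] with x hx
    exact ⟨hA.integrable_smul (memLp_gauss hκ b) f x, by rw [heq, hx]⟩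

/-! ### Uniqueness of the heat kernel -/

/-- The primitive of `d` is continuous and vanishes at the rationals, hence everywhere; Lebesgue
differentiation concludes. -/
theorem ae_eq_zero_of_forall_rat_setIntegral_eq_zero {d : ℝ → ℝ}
    (hi : ∀ q r : ℚ, IntegrableOn d (Set.Ioc (q : ℝ) r))
    (h0 : ∀ q r : ℚ, ∫ x in Set.Ioc (q : ℝ) r, d x = 0) : ∀ᵐ x, d x = 0 := by
  have hloc : LocallyIntegrable d := by
    intro x
    obtain ⟨q, hq⟩ := exists_rat_lt x
    obtain ⟨r, hr⟩ := exists_rat_gt x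
    exact ⟨_, Ioc_mem_nhds hq hr, hi q r⟩
  have hint : ∀ a b, IntervalIntegrable d volume a b := fun a b =>
    (hloc.integrableOn_isCompact isCompact_uIcc).intervalIntegrable
  have hzero : (fun x : ℝ => ∫ y in (0 : ℝ)..x, d y) = fun _ => 0 := by
    refine Rat.isDenseEmbedding_coe_real.dense.equalizer
      (intervalIntegral.continuous_primitive hint 0) continuous_const (funext fun q => ?_)
    simp only [Function.comp_apply]
    -- The oriented integral is the difference of the integrals over `Ioc 0 q` and `Ioc q 0`, so
    -- both orders enter.
    have e1 := h0 0 q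
    have e2 := h0 q 0
    rw [Rat.cast_zero] at e1 e2
    rw [intervalIntegral, e1, e2, sub_zero]
  filter_upwards [LocallyIntegrable.ae_hasDerivAt_integral hloc] with x hx
  have := hx 0
  rw [hzero] at this
  exact this.unique (hasDerivAt_const x 0)

/-- Two heat kernels of the same operator agree almost everywhere. -/
theorem IsHeatKernel.ae_eq {V : ℝ → ℝ} {p q : ℝ → ℝ → ℝ → ℝ} (hp : IsHeatKernel 𝕜 V p)
    (hq : IsHeatKernel 𝕜 V q) {t : ℝ} (ht : 0 < t) :
    ∀ᵐ z : ℝ × ℝ, p z.1 z.2 t = q z.1 z.2 t := by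
  -- Only countably many intervals are tested, so one null set of `x` serves them all.
  have hrow : ∀ᵐ x : ℝ, ∀ r s : ℚ,
      IntegrableOn (fun y => p x y t - q x y t) (Set.Ioc (r : ℝ) s) ∧
      ∫ y in Set.Ioc (r : ℝ) s, (p x y t - q x y t) = 0 := by
    rw [ae_all_iff]
    intro r
    rw [ae_all_iff]
    intro s
    have hms : MeasurableSet (Set.Ioc (r : ℝ) s) := measurableSet_Ioc
    have hfin : volume (Set.Ioc (r : ℝ) s) ≠ ⊤ := by simp
    let f : L2 𝕜 := indicatorConstLp 2 hms hfin 1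
    have hf : ∀ᵐ y, f y = (Set.Ioc (r : ℝ) s).indicator (fun _ => (1 : 𝕜)) y :=
      indicatorConstLp_coeFn
    obtain ⟨u, hu⟩ := hp.exists_solution f
    have conv : ∀ k : ℝ → ℝ, ∀ᵐ y, k y • f y
        = (((Set.Ioc (r : ℝ) s).indicator k y : ℝ) : 𝕜) := by
      intro k
      filter_upwards [hf] with y hy
      rw [hy]
      by_cases hmem : y ∈ Set.Ioc (r : ℝ) s
      · rw [Set.indicator_of_mem hmem, Set.indicator_of_mem hmem, RCLike.real_smul_eq_coe_mul,
          mul_one]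
      · rw [Set.indicator_of_notMem hmem, Set.indicator_of_notMem hmem, smul_zero,
          RCLike.ofReal_zero]
    have conv_int : ∀ k : ℝ → ℝ, Integrable (fun y => k y • f y) →
        IntegrableOn k (Set.Ioc (r : ℝ) s) := by
      intro k hk
      rw [← integrable_indicator_iff hms]
      have := ((integrable_congr (conv k)).1 hk).re
      simpa using this
    have conv_eq : ∀ k : ℝ → ℝ, ∫ y, k y • f y = ((∫ y in Set.Ioc (r : ℝ) s, k y : ℝ) : 𝕜) := by
      intro k
      rw [integral_congr_ae (conv k), integral_ofReal, integral_indicator hms]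
    filter_upwards [hp.representation f u hu t ht, hq.representation f u hu t ht] with x h1 h2
    have i1 := conv_int _ h1.1
    have i2 := conv_int _ h2.1
    refine ⟨i1.sub i2, ?_⟩
    rw [integral_sub i1 i2, sub_eq_zero]
    have := h1.2.symm.trans h2.2
    rw [conv_eq, conv_eq] at this
    exact_mod_cast this
  have hrow' : ∀ᵐ x : ℝ, ∀ᵐ y : ℝ, p x y t - q x y t = 0 := by
    filter_upwards [hrow] with x hx
    exact ae_eq_zero_of_forall_rat_setIntegral_eq_zero (fun r s => (hx r s).1)
      fun r s => (hx r s).2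
  have hmeas : AEStronglyMeasurable (fun z : ℝ × ℝ => p z.1 z.2 t - q z.1 z.2 t)
      ((volume : Measure ℝ).prod volume) := (hp.measurable t ht).sub (hq.measurable t ht)
  -- Passing from almost every row to almost every point of the plane needs a measurable set, hence
  -- the measurable representative.
  have hmk := Measure.ae_ae_of_ae_prod hmeas.ae_eq_mk
  have hset : MeasurableSet {z : ℝ × ℝ | hmeas.mk _ z = 0} :=
    hmeas.stronglyMeasurable_mk.measurable (measurableSet_singleton 0)
  have hz : ∀ᵐ z ∂(volume : Measure ℝ).prod volume, hmeas.mk _ z = 0 := by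
    rw [Measure.ae_prod_iff_ae_ae hset]
    filter_upwards [hrow', hmk] with x h1 h2
    filter_upwards [h1, h2] with y h3 h4
    rw [← h4, h3]
  rw [Measure.volume_eq_prod]
  filter_upwards [hz, hmeas.ae_eq_mk] with z h1 h2
  rw [h1] at h2
  exact sub_eq_zero.1 h2

/-! ### Quadratic potentials -/

/-- Expanding the squares about `-b` splits Mehler's exponent into parts of degree two, one and zero
in `x, y`. With `b = a₁/(2a₂)` these are the exponents of the last three factors. -/
theorem quadraticKernel_eq_mehler {a₀ a₁ a₂ : ℝ} (ha₂ : 0 < a₂) (x y t : ℝ) :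
    quadraticKernel a₀ a₁ a₂ x y t
      = mehler (√a₂) (a₁ / (2 * a₂)) (a₀ - a₁ ^ 2 / (4 * a₂)) t x y := by
  have hs : 0 < √a₂ := Real.sqrt_pos.2 ha₂
  simp only [quadraticKernel, mehler, mul_assoc, ← Real.exp_add]
  congr 2
  set c := √a₂ with hc
  have hca : a₂ = c ^ 2 := (Real.sq_sqrt ha₂.le).symm
  rw [hca]
  field_simp
  ring

end Schrodinger

end

theorem theorem2 (𝕜 : Type*) [RCLike 𝕜] (a₀ a₁ a₂ : ℝ) (ha₂ : 0 < a₂) :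
    Schrodinger.IsHeatKernel 𝕜 (fun x => a₂ * x ^ 2 + a₁ * x + a₀)
        (fun x y t => Schrodinger.quadraticKernel a₀ a₁ a₂ x y t) ∧
      (∀ t : ℝ, 0 < t →
        Continuous (fun z : ℝ × ℝ => Schrodinger.quadraticKernel a₀ a₁ a₂ z.1 z.2 t)) ∧
      ∀ p : ℝ → ℝ → ℝ → ℝ,
        Schrodinger.IsHeatKernel 𝕜 (fun x => a₂ * x ^ 2 + a₁ * x + a₀) p →
          ∀ t : ℝ, 0 < t →
            (∀ᵐ z : ℝ × ℝ, p z.1 z.2 t = Schrodinger.quadraticKernel a₀ a₁ a₂ z.1 z.2 t) ∧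
            (Continuous (fun z : ℝ × ℝ => p z.1 z.2 t) →
              ∀ x y : ℝ, p x y t = Schrodinger.quadraticKernel a₀ a₁ a₂ x y t) := by
  have hker : Schrodinger.IsHeatKernel 𝕜 (fun x => a₂ * x ^ 2 + a₁ * x + a₀)
      (fun x y t => Schrodinger.quadraticKernel a₀ a₁ a₂ x y t) := by
    have hV : (fun x : ℝ => a₂ * x ^ 2 + a₁ * x + a₀)
        = fun x => √a₂ ^ 2 * (x + a₁ / (2 * a₂)) ^ 2 + (a₀ - a₁ ^ 2 / (4 * a₂)) := by
      funext x
      rw [Real.sq_sqrt ha₂.le]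
      field_simp
      ring
    simp_rw [hV, Schrodinger.quadraticKernel_eq_mehler ha₂]
    exact Schrodinger.isHeatKernel_mehler (Real.sqrt_pos.2 ha₂)
  have hcont : ∀ t : ℝ, 0 < t →
      Continuous (fun z : ℝ × ℝ => Schrodinger.quadraticKernel a₀ a₁ a₂ z.1 z.2 t) := by
    intro t _
    unfold Schrodinger.quadraticKernel
    fun_prop
  refine ⟨hker, hcont, fun p hp t ht => ?_⟩
  have hae := hp.ae_eq hker ht
  refine ⟨hae, fun hpc x y => ?_⟩
  -- Lebesgue measure charges every nonempty open set, so continuous functions equal almost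
  -- everywhere are equal.
  exact congrFun ((hpc.ae_eq_iff_eq volume (hcont t ht)).1 hae) (x, y)
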